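/- Notation. For $f,g\in L^2(\mathbb R^d)$ let $$W(f,g)(x,\xi)=\int_{\mathbb R^d} f\left(x+\tfrac t2\right)\overline{g\left(x-\tfrac t2\right)}\,e^{-2\pi i\xi\cdot t}\,dt,\qquad (x,\xi)\in\mathbb R^{2d},$$ be the cross-Wigner distribution. A metaplectic operator with projection the symplectic matrix $S\in\mathrm{Sp}(d,\mathbb R)$ is a unitary operator $\hat S$ on $L^2(\mathbb R^d)$ such that $W(\hat Sf,\hat Sg)(z)=W(f,g)(S^{-1}z)$ for all $f,g\in L^2(\mathbb R^d)$ and $z\in\mathbb R^{2d}$; in particular this covers every $\hat S\in\mathrm{Mp}(d,\mathbb R)$. For a matrix $E$, $R(E)$ denotes its range and $E^+$ its Moore--Penrose inverse. Linear subspaces of $\mathbb R^d$ carry their Euclidean Lebesgue measure. Theorem. Let $\hat S$ be a metaplectic operator with projection $$S=\begin{pmatrix}A&B\\ C&D\end{pmatrix},\qquad A,B,C,D\in\mathbb R^{d\times d},\qquad 1\le r=\operatorname{rank}(B)\le d .$$ Let $M,N\in\mathbb R^{d\times d}$ be symmetric positive semidefinite with $\ker(M)=\ker(B)$ and $R(N)=R(B)$.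 Let $f\in L^2(\mathbb R^d)\setminus\{0\}$, and let $\alpha: D^TA(\ker(B))\to[0,\infty]$ and $\beta:A(\ker(B))\to[0,\infty]$ be measurable, almost everywhere finite functions such that for almost every $x_2\in D^TA(\ker (B))$ and almost every $\xi_2\in A(\ker (B))$ $$|f(x_1+x_2)|\le\alpha(x_2)e^{-\pi Mx_1\cdot x_1}\quad\text{for a.e. }x_1\in\ker(B)^\perp,$$ $$|\hat Sf(\xi_1+\xi_2)|\le\beta(\xi_2)e^{-\pi N\xi_1\cdot\xi_1}\quad\text{for a.e. }\xi_1\in R(B).$$ Then the matrix $MB^TNB$ has exactly $r$ non-zero eigenvalues $\lambda_1,\dots,\lambda_r$, counted with algebraic multiplicity, they are real, and: (i) $\lambda_j\le1$ for every $j=1,\dots,r$. (ii) If $\lambda_1=\dots=\lambda_r=1$, then there is $\gamma\in L^2(\ker(B))$ such that for almost every $x\in\ker(B)$ $$f(x_1+D^TAx)=\gamma(x)\,e^{-\pi(M+iB^+A)x_1\cdot x_1}\,e^{-2\pi i\,C^TAx\cdot x_1}\quad\text{for a.e. }x_1\in\ker(B)^\perp .$$ -/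

import Mathlib

noncomputable section

open MeasureTheory
open scoped ENNReal

namespace HardyMetaplectic

/-- `ℝᵈ` with its Euclidean structure. -/
abbrev Rd (d : ℕ) : Type := EuclideanSpace ℝ (Fin d)

/-- `L²(ℝᵈ)`, complex valued. -/
abbrev L2 (d : ℕ) : Type := Lp ℂ 2 (volume : Measure (Rd d))

/-- The matrix `E` acting on column vectors of `ℝᵈ`. -/
abbrev act {d : ℕ} (E : Matrix (Fin d) (Fin d) ℝ) : Rd d →ₗ[ℝ] Rd d :=
  Matrix.toEuclideanLin E

/-- The kernel of a matrix, as a subspace of `ℝᵈ`. -/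
abbrev kerM {d : ℕ} (E : Matrix (Fin d) (Fin d) ℝ) : Submodule ℝ (Rd d) :=
  LinearMap.ker (act E)

/-- The range `R(E)` of a matrix, as a subspace of `ℝᵈ`. -/
abbrev ranM {d : ℕ} (E : Matrix (Fin d) (Fin d) ℝ) : Submodule ℝ (Rd d) :=
  LinearMap.range (act E)

/-- Lebesgue measure of the Euclidean space `L` (normalized by orthonormal bases of `L`); it is not
the restriction of the Lebesgue measure of `ℝᵈ`, which vanishes on proper subspaces. On the zero
space it is the unit point mass. -/
def leb {d : ℕ} (L : Submodule ℝ (Rd d)) : Measure L :=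
  (measureSpaceOfInnerProductSpace : MeasureSpace L).volume

/-- The Moore-Penrose inverse of `E` as a linear map: the orthogonal projection onto `R(E)`
followed by the inverse of the isomorphism `ker(E)^⊥ → R(E)` induced by `E`. -/
def pinv {d : ℕ} (E : Matrix (Fin d) (Fin d) ℝ) : Rd d →ₗ[ℝ] Rd d :=
  (kerM E)ᗮ.subtype ∘ₗ
    ((act E).kerComplementEquivRange (kerM E).isCompl_orthogonal.symm).symm.toLinearMap ∘ₗ
      (ranM E).orthogonalProjectionOnto.toLinearMap

/-- The cross-Wigner distribution
`W(f,g)(x,ξ) = ∫ f(x+t/2) conj(g(x-t/2)) e^{-2πi ξ·t} dt`. For `f, g ∈ L²` the integrand is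
integrable for every `(x, ξ)`. -/
def wigner {d : ℕ} (f g : L2 d) (z : Rd d × Rd d) : ℂ :=
  ∫ t : Rd d, f (z.1 + (2⁻¹ : ℝ) • t) * starRingEnd ℂ (g (z.1 - (2⁻¹ : ℝ) • t)) *
    Complex.exp (-(2 * Real.pi * Complex.I * (inner ℝ z.2 t : ℝ)))

/-- A `2d × 2d` matrix in block form acting on `(x, ξ) ∈ ℝᵈ × ℝᵈ`. -/
def blockAct {d : ℕ} (S : Matrix (Fin d ⊕ Fin d) (Fin d ⊕ Fin d) ℝ) (z : Rd d × Rd d) :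
    Rd d × Rd d :=
  (act S.toBlocks₁₁ z.1 + act S.toBlocks₁₂ z.2, act S.toBlocks₂₁ z.1 + act S.toBlocks₂₂ z.2)

/-- `T` is a metaplectic operator with projection `S`: `S` is symplectic and `T` is a unitary
operator of `L²(ℝᵈ)` with `W(Tf,Tg)(z) = W(f,g)(S⁻¹z)` for all `f, g` and all `z`. -/
structure IsMetaplectic {d : ℕ} (S : Matrix (Fin d ⊕ Fin d) (Fin d ⊕ Fin d) ℝ)
    (T : L2 d ≃ₗᵢ[ℂ] L2 d) : Prop where
  symplectic : S ∈ Matrix.symplecticGroup (Fin d) ℝ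
  covariance : ∀ (f g : L2 d) (z : Rd d × Rd d),
    wigner (T f) (T g) z = wigner f g (blockAct S⁻¹ z)

/-- The non-zero real eigenvalues of a matrix, repeated according to algebraic multiplicity. -/
def nonzeroEigenvalues {d : ℕ} (E : Matrix (Fin d) (Fin d) ℝ) : Multiset ℝ :=
  E.charpoly.roots.filter (fun t => t ≠ 0)

end HardyMetaplectic

end

open HardyMetaplectic MeasureTheory
open scoped ENNReal Matrix

/-!
Put the coordinates `x = Dᵀ A k + v` and `ξ = A k + B u`, with `k ∈ ker B` and `u, v ∈ (ker B)ᗮ`,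
on `ℝᵈ`. Comparing matrix coefficients of parity operators, the covariance of the Wigner
distribution at the points `(0, ξ / 2)` computes the Fourier transform of `|T f|²` in terms of `f`.
Read in these coordinates, it says that for almost every `k` the slice `u ↦ |T f (A k + B u)|` is,
up to a constant, the modulus of the Fourier transform of a chirp times the slice
`v ↦ f (Dᵀ A k + v)`.

The decay hypotheses thus become those of Hardy's uncertainty principle on `(ker B)ᗮ` for the
quadratic forms of `M` and `P = Bᵀ N B`. On a complex line of direction `M w` the Fourier transform
of a slice is an entire function of order two, and the Phragmén–Lindelöf principle makes it vanish
if `P M w · M w > M w · w` and Gaussian if there is equality. An eigenvector `u` of `M P` with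
eigenvalue `μ > 1` would give the strict inequality at `w = P u`, whereas `M P M = M` if all
non-zero eigenvalues of `M P` are `1`.
-/

noncomputable section

namespace HardyMetaplectic

/-! ### Plancherel's theorem and linear changes of variables -/

section Plancherel

open scoped FourierTransform SchwartzMap ContDiff

variable {E : Type*} [NormedAddCommGroup E] [InnerProductSpace ℝ E] [FiniteDimensional ℝ E]
  [MeasurableSpace E] [BorelSpace E] {g h : E → ℂ}

theorem continuous_fourier (hg : Integrable g) : Continuous (𝓕 g) :=
  VectorFourier.fourierIntegral_continuous Real.continuous_fourierChar
    (by exact continuous_inner) hg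

theorem fourier_sub_smul (hg : Integrable g) (hh : Integrable h) (c : ℂ) (ξ : E) :
    𝓕 (g - c • h) ξ = 𝓕 g ξ - c * 𝓕 h ξ := by
  simp only [Real.fourier_eq, Pi.sub_apply, Pi.smul_apply, smul_sub]
  refine (integral_sub ((Real.fourierIntegral_convergent_iff ξ).2 hg)
    ((Real.fourierIntegral_convergent_iff ξ).2 (hh.smul c))).trans ?_
  simp only [Circle.smul_def, Pi.smul_apply, smul_eq_mul, mul_left_comm _ c, integral_const_mul]

theorem fourier_comp_add_right (g : E → ℂ) (a u : E) :
    𝓕 (fun v => g (v + a)) u =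
      Complex.exp (2 * Real.pi * Complex.I * (inner ℝ a u : ℝ)) * 𝓕 g u := by
  refine (congrFun (VectorFourier.fourierIntegral_comp_add_right Real.fourierChar volume
    (innerₗ E) g a) u).trans ?_
  rw [Circle.smul_def, Real.fourierChar_apply, smul_eq_mul, innerₗ_apply_apply]
  congr 2
  push_cast
  ring

theorem fourier_toLp_ae_eq (hg : Integrable g) (hg2 : MemLp g 2) :
    (𝓕 (hg2.toLp g) : Lp ℂ 2 (volume : Measure E)) =ᵐ[volume] 𝓕 g := by
  refine ae_eq_of_integral_contDiff_smul_eq ((Lp.memLp _).locallyIntegrable (by norm_num))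
    (continuous_fourier hg).locallyIntegrable fun φ hφ hφc => ?_
  have hφc' : HasCompactSupport fun x => (φ x : ℂ) := hφc.comp_left (g := Complex.ofReal) rfl
  have hφ' : ContDiff ℝ ∞ fun x => (φ x : ℂ) := Complex.ofRealCLM.contDiff.comp hφ
  set Φ : 𝓢(E, ℂ) := hφc'.toSchwartzMap hφ'
  have hflip : ∫ x, 𝓕 Φ x • g x = ∫ x, φ x • 𝓕 g x := by
    have := VectorFourier.integral_fourierIntegral_smul_eq_flip (L := innerₗ E) (μ := volume)
      (ν := volume) Real.continuous_fourierChar (by exact continuous_inner) Φ.integrable hg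
    rwa [flip_innerₗ] at this
  calc ∫ x, φ x • (𝓕 (hg2.toLp g) : Lp ℂ 2 (volume : Measure E)) x
      = Lp.toTemperedDistribution (𝓕 (hg2.toLp g) : Lp ℂ 2 (volume : Measure E)) Φ := by
        rw [Lp.toTemperedDistribution_apply]
        rfl
    _ = ∫ x, 𝓕 Φ x • (hg2.toLp g) x := by
        rw [← Lp.fourier_toTemperedDistribution_eq, TemperedDistribution.fourier_apply,
          Lp.toTemperedDistribution_apply]
    _ = ∫ x, 𝓕 Φ x • g x := integral_congr_ae <| by
        filter_upwards [hg2.coeFn_toLp] with x hx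
        rw [hx]
    _ = ∫ x, φ x • 𝓕 g x := hflip

theorem ae_eq_zero_of_fourier_eq_zero (hg : Integrable g) (hg2 : MemLp g 2)
    (h : ∀ w, 𝓕 g w = 0) : g =ᵐ[volume] 0 := by
  have hF : (𝓕 (hg2.toLp g) : Lp ℂ 2 (volume : Measure E)) = 0 := by
    rw [Lp.eq_zero_iff_ae_eq_zero]
    exact (fourier_toLp_ae_eq hg hg2).trans (.of_forall h)
  have hg0 : hg2.toLp g = 0 := by
    rw [← norm_eq_zero, ← Lp.norm_fourier_eq, hF, norm_zero]
  rw [Lp.eq_zero_iff_ae_eq_zero] at hg0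
  exact hg2.coeFn_toLp.symm.trans hg0

theorem memLp_two_fourier (hg : Integrable g) (hg2 : MemLp g 2) : MemLp (𝓕 g) 2 :=
  (memLp_congr_ae (fourier_toLp_ae_eq hg hg2)).1 (Lp.memLp _)

theorem integral_inner_fourier (hg : Integrable g) (hg2 : MemLp g 2) (hh : Integrable h)
    (hh2 : MemLp h 2) : ∫ u, inner ℂ (𝓕 g u) (𝓕 h u) = ∫ v, inner ℂ (g v) (h v) := by
  calc ∫ u, inner ℂ (𝓕 g u) (𝓕 h u)
      = inner ℂ (𝓕 (hg2.toLp g) : Lp ℂ 2 (volume : Measure E)) (𝓕 (hh2.toLp h)) :=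
        integral_congr_ae <| by
          filter_upwards [fourier_toLp_ae_eq hg hg2, fourier_toLp_ae_eq hh hh2] with u hu hu'
          rw [hu, hu']
    _ = inner ℂ (hg2.toLp g) (hh2.toLp h) := Lp.inner_fourier_eq _ _
    _ = ∫ v, inner ℂ (g v) (h v) := integral_congr_ae <| by
        filter_upwards [hg2.coeFn_toLp, hh2.coeFn_toLp] with v hv hv'
        rw [hv, hv']

theorem integral_norm_sq_fourier (hg : Integrable g) (hg2 : MemLp g 2) :
    ∫ u, ‖𝓕 g u‖ ^ 2 = ∫ v, ‖g v‖ ^ 2 := by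
  have h := integral_inner_fourier hg hg2 hg hg2
  simp only [inner_self_eq_norm_sq_to_K, Complex.coe_algebraMap, ← Complex.ofReal_pow,
    integral_complex_ofReal] at h
  exact_mod_cast h

theorem integral_norm_sq_fourier_mul_exp (hg : Integrable g) (hg2 : MemLp g 2) (a : E) :
    ∫ u, ((‖𝓕 g u‖ ^ 2 : ℝ) : ℂ) * Complex.exp (2 * Real.pi * Complex.I * (inner ℝ a u : ℝ)) =
      ∫ v, starRingEnd ℂ (g v) * g (v + a) := by
  have h := integral_inner_fourier hg hg2 (hg.comp_add_right a)
    (hg2.comp_measurePreserving (measurePreserving_add_right _ a))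
  simp only [RCLike.inner_apply, fourier_comp_add_right, mul_assoc _ (𝓕 g _),
    Complex.mul_conj, Complex.normSq_eq_norm_sq] at h
  simpa only [mul_comm] using h

end Plancherel

section HaarMap

variable {X Y : Type*} [NormedAddCommGroup X] [NormedSpace ℝ X] [MeasurableSpace X] [BorelSpace X]
  [NormedAddCommGroup Y] [NormedSpace ℝ Y] [FiniteDimensional ℝ Y] [MeasurableSpace Y]
  [BorelSpace Y] (e : X ≃L[ℝ] Y) (μ : Measure X) [μ.IsAddHaarMeasure] (ν : Measure Y)
  [ν.IsAddHaarMeasure]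

theorem exists_map_eq_smul_haar : ∃ c : ℝ≥0∞, c ≠ 0 ∧ c ≠ ∞ ∧ μ.map e = c • ν := by
  have := e.isAddHaarMeasure_map μ
  refine ⟨Measure.addHaarScalarFactor (μ.map e) ν, ?_, ENNReal.coe_ne_top,
    Measure.isAddLeftInvariant_eq_smul _ _⟩
  exact ENNReal.coe_ne_zero.2 (Measure.addHaarScalarFactor_pos_of_isAddHaarMeasure _ _).ne'

theorem quasiMeasurePreserving_linearEquiv : Measure.QuasiMeasurePreserving e μ ν := by
  obtain ⟨c, -, -, h⟩ := exists_map_eq_smul_haar e μ ν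
  exact ⟨e.continuous.measurable, h ▸ Measure.smul_absolutelyContinuous⟩

theorem exists_integral_comp_linearEquiv :
    ∃ c : ℝ, 0 < c ∧ ∀ g : Y → ℂ, ∫ x, g (e x) ∂μ = c * ∫ y, g y ∂ν := by
  obtain ⟨c, hc0, hc, h⟩ := exists_map_eq_smul_haar e μ ν
  refine ⟨c.toReal, ENNReal.toReal_pos hc0 hc, fun g => ?_⟩
  rw [← Complex.real_smul, ← integral_smul_measure, ← h]
  exact (integral_map_equiv e.toHomeomorph.toMeasurableEquiv g).symm

variable {μ ν} in
theorem memLp_comp_linearEquiv {g : Y → ℂ} {p : ℝ≥0∞} (hg : MemLp g p ν) :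
    MemLp (fun x => g (e x)) p μ := by
  obtain ⟨c, -, hc, h⟩ := exists_map_eq_smul_haar e μ ν
  exact (h ▸ hg.smul_measure hc).comp_of_map e.continuous.aemeasurable

end HaarMap

/-! ### The Phragmén–Lindelöf principle for functions of Gaussian growth -/

section PhragmenLindelof

open Complex Filter Topology

theorem norm_le_of_sector {F : Type*} [NormedAddCommGroup F] [NormedSpace ℂ F] {f : ℂ → F}
    {θ A b c C : ℝ} (hθ : θ ≤ Real.pi) (hf : DiffContOnCl ℂ f {z | z.arg ∈ Set.Ioo 0 θ})
    (hb : 0 ≤ b) (hc : 0 ≤ c) (hcθ : c < Real.pi / θ)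
    (hgrowth : ∀ z : ℂ, z.arg ∈ Set.Ioo 0 θ → ‖f z‖ ≤ A * Real.exp (b * ‖z‖ ^ c))
    (hreal : ∀ t : ℝ, 0 < t → ‖f t‖ ≤ C) (hray : ∀ t : ℝ, 0 < t → ‖f (t * exp (θ * I))‖ ≤ C)
    {z : ℂ} (hz : z ≠ 0) (h0 : 0 ≤ z.arg) (hzθ : z.arg ≤ θ) : ‖f z‖ ≤ C := by
  have harg : ∀ w : ℂ, w.im ∈ Set.Ioo 0 θ → (exp w).arg ∈ Set.Ioo 0 θ := fun w hw => by
    rwa [arg_exp, (toIocMod_eq_self _).2]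
    constructor <;> linarith [hw.1, hw.2, Real.pi_pos]
  have hstrip := PhragmenLindelof.horizontal_strip (f := f ∘ exp) (a := 0) (b := θ) (C := C)
    (z := log z) (hf.comp differentiable_exp.diffContOnCl harg) ?_ ?_ ?_ (by rwa [log_im])
    (by rwa [log_im])
  · simpa only [Function.comp_apply, exp_log hz] using hstrip
  · refine ⟨c, by rwa [sub_zero], b, .of_bound ‖A‖ ?_⟩
    filter_upwards [mem_inf_of_right (mem_principal_self _)] with w hw
    rw [Real.norm_eq_abs (Real.exp _), Real.abs_exp]
    refine (hgrowth _ (harg w hw)).trans ?_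
    rw [norm_exp, ← Real.exp_mul, mul_comm w.re]
    gcongr
    exacts [Real.le_norm_self A, le_abs_self _]
  · intro w hw
    rw [Function.comp_apply, ← re_add_im w, hw, ofReal_zero, zero_mul, add_zero, ← ofReal_exp]
    exact hreal _ (Real.exp_pos _)
  · intro w hw
    rw [Function.comp_apply, ← re_add_im w, hw, exp_add, ← ofReal_exp]
    exact hray _ (Real.exp_pos _)

theorem norm_exp_I_mul_sq (s : ℝ) (z : ℂ) :
    ‖exp (I * s * z ^ 2)‖ = Real.exp (-(2 * s * (z.re * z.im))) := by
  rw [norm_exp]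
  congr 1
  simp [pow_two]
  ring

section GaussianGrowth

variable {H : ℂ → ℂ} {C a : ℝ}

-- `exp (i s z²)` has modulus at most `1` on the sector, and its decay on the ray of angle `θ`
-- cancels the growth of `H` there.
theorem norm_mul_exp_I_mul_sq_le (hH : Differentiable ℂ H) (ha : 0 ≤ a)
    (hC : ∀ z : ℂ, ‖H z‖ ≤ C * Real.exp (a * z.re ^ 2)) (hR : ∀ t : ℝ, ‖H t‖ ≤ C) {s θ : ℝ}
    (hs : 0 ≤ s) (hsθ : a * Real.cos θ = 2 * s * Real.sin θ) (hθ : θ < Real.pi / 2) {z : ℂ}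
    (hz : 0 < z.arg) (hzθ : z.arg ≤ θ) : ‖H z * exp (I * s * z ^ 2)‖ ≤ C := by
  have hnorm (w : ℂ) :
      ‖H w * exp (I * s * w ^ 2)‖ = ‖H w‖ * Real.exp (-(2 * s * (w.re * w.im))) := by
    rw [norm_mul, norm_exp_I_mul_sq]
  refine norm_le_of_sector (f := fun w => H w * exp (I * s * w ^ 2)) (A := C) (b := a) (c := 2)
    (by linarith) (hH.mul (by fun_prop)).diffContOnCl ha zero_le_two ?_ ?_ ?_ ?_
    (fun h => by simp [h] at hz) hz.le hzθ
  · rw [lt_div_iff₀ (hz.trans_le hzθ)]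
    linarith
  · intro w hw
    have hC0 : 0 ≤ C := (norm_nonneg _).trans (hR 0)
    have hre : 0 ≤ w.re := abs_arg_le_pi_div_two_iff.1
      (abs_le.2 ⟨by linarith [hw.1], by linarith [hw.2]⟩)
    have him : 0 ≤ w.im := arg_nonneg_iff.1 hw.1.le
    rw [hnorm]
    refine (mul_le_of_le_one_right (norm_nonneg _) (Real.exp_le_one_iff.2 ?_)).trans
      ((hC w).trans ?_)
    · exact neg_nonpos.2 (by positivity)
    · rw [Real.rpow_two]
      gcongr
      exact re_le_norm w
  · intro t _
    simpa only [hnorm, ofReal_re, ofReal_im, mul_zero, neg_zero, Real.exp_zero, mul_one] using hR t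
  · intro t _
    rw [hnorm]
    refine (mul_le_mul_of_nonneg_right (hC _) (Real.exp_nonneg _)).trans_eq ?_
    rw [mul_assoc, ← Real.exp_add]
    simp only [re_ofReal_mul, im_ofReal_mul, exp_ofReal_mul_I_re, exp_ofReal_mul_I_im]
    rw [show a * (t * Real.cos θ) ^ 2 + -(2 * s * (t * Real.cos θ * (t * Real.sin θ))) = 0 by
      linear_combination t ^ 2 * Real.cos θ * hsθ, Real.exp_zero, mul_one]

theorem norm_le_of_gaussian_growth_sector (hH : Differentiable ℂ H) (ha : 0 ≤ a)
    (hC : ∀ z : ℂ, ‖H z‖ ≤ C * Real.exp (a * z.re ^ 2)) (hR : ∀ t : ℝ, ‖H t‖ ≤ C)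
    {z : ℂ} {θ : ℝ} (hz : 0 < z.arg) (hzθ : z.arg ≤ θ) (hθ : θ < Real.pi / 2) :
    ‖H z‖ ≤ C * Real.exp (a * (Real.cos θ / Real.sin θ) * (z.re * z.im)) := by
  have hθ0 : 0 < θ := hz.trans_le hzθ
  have hcos : 0 < Real.cos θ := Real.cos_pos_of_mem_Ioo ⟨by linarith, hθ⟩
  have hsin : 0 < Real.sin θ := Real.sin_pos_of_pos_of_lt_pi hθ0 (by linarith)
  set s : ℝ := a * Real.cos θ / (2 * Real.sin θ) with hs
  have hbound : ‖H z * exp (I * s * z ^ 2)‖ ≤ C :=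
    norm_mul_exp_I_mul_sq_le hH ha hC hR (by positivity) (by rw [hs]; field_simp) hθ hz hzθ
  calc ‖H z‖ = ‖H z * exp (I * s * z ^ 2)‖ * Real.exp (2 * s * (z.re * z.im)) := by
        rw [norm_mul, norm_exp_I_mul_sq, mul_assoc, ← Real.exp_add, neg_add_cancel, Real.exp_zero,
          mul_one]
    _ ≤ C * Real.exp (2 * s * (z.re * z.im)) := by gcongr
    _ = C * Real.exp (a * (Real.cos θ / Real.sin θ) * (z.re * z.im)) := by
        rw [hs]
        field_simp

theorem norm_le_of_gaussian_growth_quadrant (hH : Differentiable ℂ H) (ha : 0 ≤ a)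
    (hC : ∀ z : ℂ, ‖H z‖ ≤ C * Real.exp (a * z.re ^ 2)) (hR : ∀ t : ℝ, ‖H t‖ ≤ C)
    {z : ℂ} (hre : 0 < z.re) (him : 0 < z.im) : ‖H z‖ ≤ C := by
  have harg0 : 0 < z.arg := (arg_nonneg_iff.2 him.le).lt_of_ne'
    fun h => him.ne' (arg_eq_zero_iff.1 h).2
  have harg1 : z.arg < Real.pi / 2 := arg_lt_pi_div_two_iff.2 (Or.inl hre)
  have hlim : Tendsto (fun θ : ℝ => C * Real.exp (a * (Real.cos θ / Real.sin θ) * (z.re * z.im)))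
      (𝓝[<] (Real.pi / 2)) (𝓝 C) := by
    have hcont : ContinuousAt
        (fun θ : ℝ => C * Real.exp (a * (Real.cos θ / Real.sin θ) * (z.re * z.im)))
        (Real.pi / 2) := by
      fun_prop (disch := simp)
    simpa using hcont.tendsto.mono_left nhdsWithin_le_nhds
  refine ge_of_tendsto hlim ?_
  filter_upwards [Ioo_mem_nhdsLT harg1] with θ hθ
  exact norm_le_of_gaussian_growth_sector hH ha hC hR harg0 hθ.1.le hθ.2

theorem norm_le_of_gaussian_growth_right (hH : Differentiable ℂ H) (ha : 0 ≤ a)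
    (hC : ∀ z : ℂ, ‖H z‖ ≤ C * Real.exp (a * z.re ^ 2)) (hR : ∀ t : ℝ, ‖H t‖ ≤ C)
    {z : ℂ} (hre : 0 ≤ z.re) : ‖H z‖ ≤ C := by
  rcases hre.eq_or_lt with h | h
  · simpa [← h] using hC z
  rcases lt_trichotomy z.im 0 with h' | h' | h'
  · have hconj : Differentiable ℂ (fun w => starRingEnd ℂ (H (starRingEnd ℂ w))) := fun w => by
      simpa only [conj_conj, Function.comp_def] using (hH (starRingEnd ℂ w)).conj_conj
    simpa using norm_le_of_gaussian_growth_quadrant hconj ha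
      (fun w => by simpa using hC (starRingEnd ℂ w)) (fun t => by simpa using hR t)
      (z := starRingEnd ℂ z) (by simpa using h) (by simpa using h')
  · exact conj_eq_iff_re.1 (conj_eq_iff_im.2 h') ▸ hR z.re
  · exact norm_le_of_gaussian_growth_quadrant hH ha hC hR h h'

theorem norm_le_of_gaussian_growth (hH : Differentiable ℂ H) (ha : 0 ≤ a)
    (hC : ∀ z : ℂ, ‖H z‖ ≤ C * Real.exp (a * z.re ^ 2)) (hR : ∀ t : ℝ, ‖H t‖ ≤ C)
    (z : ℂ) : ‖H z‖ ≤ C := by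
  rcases le_total 0 z.re with h | h
  · exact norm_le_of_gaussian_growth_right hH ha hC hR h
  · simpa using norm_le_of_gaussian_growth_right (H := fun w => H (-w)) (hH.comp differentiable_neg)
      ha (fun w => by simpa using hC (-w)) (fun t => by simpa using hR (-t)) (z := -z)
      (by simpa using h)

theorem eq_gaussian_of_gaussian_bounds {F : ℂ → ℂ} (hF : Differentiable ℂ F) {C' : ℝ} (ha : 0 ≤ a)
    (hC : ∀ z : ℂ, ‖F z‖ ≤ C * Real.exp (a * z.im ^ 2))
    (hR : ∀ t : ℝ, ‖F t‖ ≤ C' * Real.exp (-(a * t ^ 2))) (z : ℂ) :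
    F z = F 0 * exp (-(a * z ^ 2)) := by
  set H : ℂ → ℂ := fun w => F w * exp (a * w ^ 2) with hHdef
  have hH : Differentiable ℂ H := hF.mul (by fun_prop)
  have hnorm (w : ℂ) : ‖H w‖ = ‖F w‖ * Real.exp (a * (w.re ^ 2 - w.im ^ 2)) := by
    rw [norm_mul, norm_exp]
    simp [pow_two]
  have hbounded (w : ℂ) : ‖H w‖ ≤ max C C' := by
    refine norm_le_of_gaussian_growth hH ha (fun w => ?_) (fun t => ?_) w
    · refine (hnorm w).trans_le
        ((mul_le_mul_of_nonneg_right (hC w) (Real.exp_nonneg _)).trans ?_)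
      rw [mul_assoc, ← Real.exp_add,
        show a * w.im ^ 2 + a * (w.re ^ 2 - w.im ^ 2) = a * w.re ^ 2 by ring]
      gcongr
      exact le_max_left C C'
    · refine (hnorm t).trans_le
        ((mul_le_mul_of_nonneg_right (hR t) (Real.exp_nonneg _)).trans ?_)
      rw [mul_assoc, ← Real.exp_add]
      simp
  have hliouville : H z = H 0 := hH.apply_eq_apply_of_bounded
    (isBounded_iff_forall_norm_le.2 ⟨max C C', Set.forall_mem_range.2 hbounded⟩) z 0
  rw [show F 0 = H 0 by simp [hHdef], ← hliouville, hHdef]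
  simp only [mul_assoc, ← exp_add, add_neg_cancel, exp_zero, mul_one]

-- Completing the square bounds `F` on the real line by a Gaussian of rate between `a` and `q`, but
-- `F` is a Gaussian of rate `a` there.
theorem eq_zero_of_gaussian_bounds {F : ℂ → ℂ} (hF : Differentiable ℂ F) {C' q m n : ℝ}
    (ha : 0 ≤ a) (hq : a < q) (hC : ∀ z : ℂ, ‖F z‖ ≤ C * Real.exp (a * z.im ^ 2))
    (hR : ∀ t : ℝ, ‖F t‖ ≤ C' * Real.exp (-(q * t ^ 2 + m * t + n))) : F = 0 := by
  have hC' : 0 ≤ C' := nonneg_of_mul_nonneg_left ((norm_nonneg _).trans (hR 0)) (Real.exp_pos _)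
  obtain ⟨δ, hδ, rfl⟩ : ∃ δ > 0, q = a + δ := ⟨q - a, sub_pos.2 hq, by ring⟩
  set K := C' * Real.exp (m ^ 2 / (2 * δ) - n) with hK
  have hdecay (t : ℝ) : ‖F t‖ ≤ K * Real.exp (-(δ / 2 * t ^ 2)) * Real.exp (-(a * t ^ 2)) := by
    refine (hR t).trans ?_
    rw [hK, mul_assoc, mul_assoc, ← Real.exp_add, ← Real.exp_add]
    gcongr
    have hsquare : 0 ≤ (t * δ + m) ^ 2 / (2 * δ) := by positivity
    have hexpand : (t * δ + m) ^ 2 / (2 * δ) = t ^ 2 * δ / 2 + t * m + m ^ 2 / (2 * δ) := by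
      field_simp
      ring
    linarith
  have hgauss := eq_gaussian_of_gaussian_bounds hF ha hC (C' := K) fun t =>
    (hdecay t).trans (by
      gcongr
      exact mul_le_of_le_one_right (by positivity)
        (Real.exp_le_one_iff.2 (neg_nonpos.2 (by positivity))))
  have hle (t : ℝ) : ‖F 0‖ ≤ K * Real.exp (-(δ / 2 * t ^ 2)) := by
    have h := hdecay t
    rw [hgauss t, norm_mul, show (-(a * (t : ℂ) ^ 2)) = ((-(a * t ^ 2) : ℝ) : ℂ) by push_cast; rfl,
      norm_exp_ofReal] at h
    exact le_of_mul_le_mul_right h (Real.exp_pos _)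
  have hlim : Tendsto (fun t : ℝ => K * Real.exp (-(δ / 2 * t ^ 2))) atTop (𝓝 0) := by
    simpa using (Real.tendsto_exp_neg_atTop_nhds_zero.comp
      ((tendsto_pow_atTop two_ne_zero).const_mul_atTop (half_pos hδ))).const_mul K
  have h0 : F 0 = 0 := norm_le_zero_iff.1 (ge_of_tendsto hlim (Eventually.of_forall hle))
  exact funext fun z => by rw [hgauss z, h0, zero_mul, Pi.zero_apply]

end GaussianGrowth

end PhragmenLindelof

/-! ### Hardy's uncertainty principle -/

section Hardy

open Filter Topology
open scoped FourierTransform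

theorem mul_exp_le_exp_mul_add_exp_neg_mul {c r t y : ℝ} (hy : |y| ≤ r) (hr : r + 1 ≤ c) :
    |t| * Real.exp (y * t) ≤ Real.exp (c * t) + Real.exp (-c * t) := by
  have hyt : y * t ≤ r * |t| :=
    (le_abs_self _).trans (abs_mul y t ▸ mul_le_mul_of_nonneg_right hy (abs_nonneg t))
  calc |t| * Real.exp (y * t) ≤ Real.exp |t| * Real.exp (r * |t|) := by
        gcongr
        linarith [Real.add_one_le_exp |t|]
    _ = Real.exp ((r + 1) * |t|) := by
        rw [← Real.exp_add]
        ring_nf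
    _ ≤ Real.exp (c * |t|) := by gcongr
    _ ≤ Real.exp (c * t) + Real.exp (-c * t) := by
        rcases abs_choice t with h | h <;> rw [h]
        · exact le_add_of_nonneg_right (Real.exp_nonneg _)
        · rw [mul_neg, ← neg_mul]
          exact le_add_of_nonneg_left (Real.exp_nonneg _)

theorem differentiable_integral_mul_cexp {Ω : Type*} [MeasurableSpace Ω] {μ : Measure Ω}
    {g : Ω → ℂ} {ψ : Ω → ℝ} (hg : AEStronglyMeasurable g μ) (hψ : AEMeasurable ψ μ)
    (hint : ∀ c : ℝ, Integrable (fun x => ‖g x‖ * Real.exp (c * ψ x)) μ) :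
    Differentiable ℂ fun z : ℂ => ∫ x, g x * Complex.exp (z * ψ x) ∂μ := by
  intro z₀
  set c : ℝ := |z₀.re| + 2
  have hnorm (z : ℂ) (x : Ω) : ‖Complex.exp (z * ψ x)‖ = Real.exp (z.re * ψ x) := by
    rw [Complex.norm_exp, Complex.re_mul_ofReal]
  have hψ' : AEMeasurable (fun x => (ψ x : ℂ)) μ := Complex.measurable_ofReal.comp_aemeasurable hψ
  have hmeas (z : ℂ) : AEStronglyMeasurable (fun x => Complex.exp (z * ψ x)) μ :=
    (Complex.measurable_exp.comp_aemeasurable (hψ'.const_mul z)).aestronglyMeasurable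
  refine (hasDerivAt_integral_of_dominated_loc_of_deriv_le
    (F' := fun z x => g x * (Complex.exp (z * ψ x) * ψ x))
    (bound := fun x => ‖g x‖ * Real.exp (c * ψ x) + ‖g x‖ * Real.exp (-c * ψ x))
    (Metric.ball_mem_nhds z₀ one_pos) (.of_forall fun z => hg.mul (hmeas z)) ?_
    (hg.mul ((hmeas z₀).mul hψ'.aestronglyMeasurable)) (.of_forall fun x z hz => ?_)
    ((hint c).add (hint (-c))) (.of_forall fun x z _ => ?_)).2.differentiableAt
  · refine (hint z₀.re).mono' (hg.mul (hmeas z₀)) (.of_forall fun x => ?_)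
    rw [Pi.mul_apply, norm_mul, hnorm]
  · have hre : |z.re| ≤ |z₀.re| + 1 := by
      have h := (Complex.abs_re_le_norm (z - z₀)).trans (mem_ball_iff_norm.1 hz).le
      rw [Complex.sub_re] at h
      linarith [abs_sub_abs_le_abs_sub z.re z₀.re]
    rw [norm_mul, norm_mul, hnorm, Complex.norm_real, Real.norm_eq_abs, ← mul_add,
      mul_comm (Real.exp _)]
    gcongr
    exact mul_exp_le_exp_mul_add_exp_neg_mul hre (by simp only [c]; linarith)
  · exact ((hasDerivAt_id z).mul_const (ψ x : ℂ)).cexp.const_mul (g x) |>.congr_deriv (by simp)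

theorem eq_of_eq_on_imaginary_axis {F G : ℂ → ℂ} (hF : Differentiable ℂ F)
    (hG : Differentiable ℂ G) (h : ∀ y : ℝ, F (y * Complex.I) = G (y * Complex.I)) : F = G := by
  refine AnalyticOnNhd.eq_of_frequently_eq (z₀ := 0) (fun z _ => hF.analyticAt z)
    (fun z _ => hG.analyticAt z) ?_
  have haxis : Tendsto (fun y : ℝ => (y * Complex.I : ℂ)) (𝓝[≠] 0) (𝓝[≠] 0) := by
    refine tendsto_nhdsWithin_iff.2 ⟨?_, ?_⟩
    · exact (Continuous.tendsto' (by fun_prop) 0 0 (by simp)).mono_left nhdsWithin_le_nhds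
    · filter_upwards [self_mem_nhdsWithin] with y hy
      simpa using hy
  exact haxis.frequently (Eventually.of_forall h).frequently

variable {V : Type*} [NormedAddCommGroup V] [InnerProductSpace ℝ V]

/-- The Gaussian `e^{-π M x · x}` of the quadratic form of `M`. -/
def gaussian (M : V →ₗ[ℝ] V) (x : V) : ℝ :=
  Real.exp (-Real.pi * inner ℝ (M x) x)

theorem gaussian_pos (M : V →ₗ[ℝ] V) (x : V) : 0 < gaussian M x :=
  Real.exp_pos _

theorem inner_map_self_nonneg {M : V →ₗ[ℝ] V} (hpos : ∀ x, x ≠ 0 → 0 < inner ℝ (M x) x) (x : V) :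
    0 ≤ inner ℝ (M x) x := by
  rcases eq_or_ne x 0 with rfl | hx
  · simp
  · exact (hpos x hx).le

theorem gaussian_le_one {M : V →ₗ[ℝ] V} (hpos : ∀ x, x ≠ 0 → 0 < inner ℝ (M x) x) (x : V) :
    gaussian M x ≤ 1 := by
  rw [gaussian, Real.exp_le_one_iff, neg_mul, neg_nonpos]
  exact mul_nonneg Real.pi_pos.le (inner_map_self_nonneg hpos x)

theorem gaussian_mul_exp {M : V →ₗ[ℝ] V} (hM : M.IsSymmetric) (w x : V) (y : ℝ) :
    gaussian M x * Real.exp (2 * Real.pi * y * inner ℝ (M w) x) =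
      Real.exp (Real.pi * inner ℝ (M w) w * y ^ 2) * gaussian M (x - y • w) := by
  rw [gaussian, gaussian, ← Real.exp_add, ← Real.exp_add]
  congr 1
  simp only [map_sub, map_smul, inner_sub_left, inner_sub_right, real_inner_smul_left,
    real_inner_smul_right, hM x w, real_inner_comm x (M w)]
  ring

variable [FiniteDimensional ℝ V]

theorem exists_pos_mul_norm_sq_le_inner {M : V →ₗ[ℝ] V} (hpos : ∀ x, x ≠ 0 → 0 < inner ℝ (M x) x) :
    ∃ m > 0, ∀ x, m * ‖x‖ ^ 2 ≤ inner ℝ (M x) x := by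
  rcases subsingleton_or_nontrivial V with _ | _
  · exact ⟨1, one_pos, fun x => by simp [Subsingleton.elim x 0]⟩
  have hcont : Continuous fun x => inner ℝ (M x) x :=
    M.continuous_of_finiteDimensional.inner continuous_id
  obtain ⟨x₀, hx₀, hmin⟩ := (isCompact_sphere (0 : V) 1).exists_isMinOn
    (NormedSpace.sphere_nonempty.2 zero_le_one) hcont.continuousOn
  refine ⟨inner ℝ (M x₀) x₀, hpos x₀ (ne_zero_of_mem_unit_sphere ⟨x₀, hx₀⟩), fun x => ?_⟩
  rcases eq_or_ne x 0 with rfl | hx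
  · simp
  have h : inner ℝ (M x₀) x₀ ≤ inner ℝ (M (‖x‖⁻¹ • x)) (‖x‖⁻¹ • x) :=
    hmin (by simp [norm_smul, hx])
  rw [map_smul, real_inner_smul_left, real_inner_smul_right, ← mul_assoc, ← mul_inv, ← sq,
    inv_mul_eq_div, le_div_iff₀ (by positivity)] at h
  exact h

theorem continuous_gaussian (M : V →ₗ[ℝ] V) : Continuous (gaussian M) :=
  Real.continuous_exp.comp
    (continuous_const.mul (M.continuous_of_finiteDimensional.inner continuous_id))

variable [MeasurableSpace V] [BorelSpace V] {M : V →ₗ[ℝ] V} {g : V → ℂ}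

theorem integrable_gaussian (hpos : ∀ x, x ≠ 0 → 0 < inner ℝ (M x) x) :
    Integrable (gaussian M) := by
  obtain ⟨m, hm, hle⟩ := exists_pos_mul_norm_sq_le_inner hpos
  have h := (GaussianFourier.integrable_cexp_neg_mul_sq_norm_add
    (b := ((Real.pi * m : ℝ) : ℂ)) (by simpa using mul_pos Real.pi_pos hm) 0 (0 : V)).norm
  refine h.mono' (continuous_gaussian M).aestronglyMeasurable (.of_forall fun x => ?_)
  rw [Real.norm_of_nonneg (gaussian_pos M x).le, gaussian, Complex.norm_exp]
  gcongr
  rw [zero_mul, add_zero, ← Complex.ofReal_neg, ← Complex.ofReal_pow, ← Complex.ofReal_mul,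
    Complex.ofReal_re, neg_mul, neg_mul, mul_assoc]
  gcongr
  exact hle x

theorem integrable_gaussian_mul_exp (hM : M.IsSymmetric)
    (hpos : ∀ x, x ≠ 0 → 0 < inner ℝ (M x) x) (w : V) (y : ℝ) :
    Integrable fun x => gaussian M x * Real.exp (2 * Real.pi * y * inner ℝ (M w) x) := by
  simp only [gaussian_mul_exp hM]
  exact ((integrable_gaussian hpos).comp_sub_right (y • w)).const_mul _

theorem integral_gaussian_mul_exp (hM : M.IsSymmetric) (w : V) (y : ℝ) :
    ∫ x, gaussian M x * Real.exp (2 * Real.pi * y * inner ℝ (M w) x) =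
      Real.exp (Real.pi * inner ℝ (M w) w * y ^ 2) * ∫ x, gaussian M x := by
  simp only [gaussian_mul_exp hM]
  rw [integral_const_mul, integral_sub_right_eq_self]

/-- `g` is dominated almost everywhere by a multiple of the Gaussian of `M`: the hypothesis that
Hardy's uncertainty principle puts on a function and on its Fourier transform. -/
def GaussianDecay (M : V →ₗ[ℝ] V) (g : V → ℂ) : Prop :=
  ∃ a : ℝ, ∀ᵐ x, ‖g x‖ ≤ a * gaussian M x

theorem gaussianDecay_gaussian (M : V →ₗ[ℝ] V) : GaussianDecay M fun x => (gaussian M x : ℂ) :=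
  ⟨1, .of_forall fun x => by
    rw [Complex.norm_real, Real.norm_of_nonneg (gaussian_pos M x).le, one_mul]⟩

namespace GaussianDecay

theorem integrable (h : GaussianDecay M g) (hpos : ∀ x, x ≠ 0 → 0 < inner ℝ (M x) x)
    (hg : AEStronglyMeasurable g) : Integrable g :=
  let ⟨a, ha⟩ := h
  ((integrable_gaussian hpos).const_mul a).mono' hg ha

theorem forall_le (h : GaussianDecay M g) (hg : Continuous g) :
    ∃ a : ℝ, ∀ x, ‖g x‖ ≤ a * gaussian M x := by
  obtain ⟨a, ha⟩ := h
  exact ⟨a, fun x => (Measure.dense_of_ae ha).induction (fun _ => id)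
    (isClosed_le hg.norm (continuous_const.mul (continuous_gaussian M))) x⟩

theorem memLp_two (h : GaussianDecay M g) (hpos : ∀ x, x ≠ 0 → 0 < inner ℝ (M x) x)
    (hg : AEStronglyMeasurable g) : MemLp g 2 := by
  have hint := h.integrable hpos hg
  obtain ⟨a, ha⟩ := h
  have hbdd : ∀ᵐ x, ‖‖g x‖‖ ≤ |a| := by
    filter_upwards [ha] with x hx
    rw [norm_norm]
    exact hx.trans ((mul_le_mul_of_nonneg_right (le_abs_self a) (gaussian_pos M x).le).trans
      (mul_le_of_le_one_right (abs_nonneg a) (gaussian_le_one hpos x)))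
  rw [memLp_two_iff_integrable_sq_norm hg]
  simpa only [sq] using hint.norm.bdd_mul hg.norm hbdd

end GaussianDecay

/-- The Fourier transform of `g` on the complexified line `ξ + ℂ w`. -/
def fourierLine (g : V → ℂ) (ξ w : V) (z : ℂ) : ℂ :=
  ∫ x, g x * Complex.exp (-(2 * Real.pi * Complex.I *
    ((inner ℝ ξ x : ℝ) + z * (inner ℝ w x : ℝ))))

theorem fourierLine_ofReal (g : V → ℂ) (ξ w : V) (t : ℝ) :
    fourierLine g ξ w t = 𝓕 g (ξ + t • w) := by
  rw [Real.fourier_eq', fourierLine]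
  refine integral_congr_ae (.of_forall fun x => ?_)
  simp only [smul_eq_mul]
  rw [mul_comm, inner_add_right, real_inner_smul_right, real_inner_comm x ξ, real_inner_comm x w]
  push_cast
  ring_nf

theorem fourierLine_zero (g : V → ℂ) (ξ w : V) : fourierLine g ξ w 0 = 𝓕 g ξ := by
  simpa using fourierLine_ofReal g ξ w 0

namespace GaussianDecay

theorem norm_fourierLine_le (h : GaussianDecay M g) (hM : M.IsSymmetric)
    (hpos : ∀ x, x ≠ 0 → 0 < inner ℝ (M x) x) :
    ∃ C, ∀ ξ w z,
      ‖fourierLine g ξ (M w) z‖ ≤ C * Real.exp (Real.pi * inner ℝ (M w) w * z.im ^ 2) := by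
  obtain ⟨a, ha⟩ := h
  refine ⟨a * ∫ x : V, gaussian M x, fun ξ w z => ?_⟩
  refine (norm_integral_le_of_norm_le (μ := (volume : Measure V))
    ((integrable_gaussian_mul_exp hM hpos w z.im).const_mul a) ?_).trans_eq ?_
  · filter_upwards [ha] with x hx
    have hexp : ‖Complex.exp (-(2 * Real.pi * Complex.I *
        ((inner ℝ ξ x : ℝ) + z * (inner ℝ (M w) x : ℝ))))‖ =
        Real.exp (2 * Real.pi * z.im * inner ℝ (M w) x) := by
      rw [Complex.norm_exp]
      congr 1
      simp
      ring
    rw [norm_mul, hexp, ← mul_assoc]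
    gcongr
  · rw [integral_const_mul, integral_gaussian_mul_exp hM, mul_left_comm, mul_comm, mul_assoc]

theorem differentiable_fourierLine (h : GaussianDecay M g) (hM : M.IsSymmetric)
    (hpos : ∀ x, x ≠ 0 → 0 < inner ℝ (M x) x) (hg : AEStronglyMeasurable g) (ξ w : V) :
    Differentiable ℂ (fourierLine g ξ (M w)) := by
  obtain ⟨a, ha⟩ := h
  set h : V → ℂ := fun x => g x * Complex.exp (-(2 * Real.pi * Complex.I * (inner ℝ ξ x : ℝ)))
  have hh : AEStronglyMeasurable h :=
    hg.mul (Continuous.aestronglyMeasurable (by fun_prop))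
  have hnorm (x : V) : ‖h x‖ = ‖g x‖ := by
    simp [h, Complex.norm_exp]
  have heq (z : ℂ) : fourierLine g ξ (M w) z =
      ∫ x, h x * Complex.exp (-(2 * Real.pi * Complex.I) * z * (inner ℝ (M w) x : ℝ)) := by
    refine integral_congr_ae (.of_forall fun x => ?_)
    simp only [h, mul_assoc, ← Complex.exp_add]
    ring_nf
  rw [funext heq]
  refine (differentiable_integral_mul_cexp (ψ := fun x => inner ℝ (M w) x) hh
    (by fun_prop) fun c => ?_).comp (differentiable_id.const_mul (-(2 * Real.pi * Complex.I)))
  refine ((integrable_gaussian_mul_exp hM hpos w (c / (2 * Real.pi))).const_mul a).mono'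
    (hh.norm.mul (Continuous.aestronglyMeasurable (by fun_prop))) ?_
  filter_upwards [ha] with x hx
  rw [norm_mul, norm_norm, hnorm, Real.norm_of_nonneg (Real.exp_nonneg _),
    mul_div_cancel₀ _ Real.two_pi_pos.ne', ← mul_assoc]
  gcongr

theorem ae_eq_zero {P : V →ₗ[ℝ] V} (hgM : GaussianDecay M g) (hgP : GaussianDecay P (𝓕 g))
    (hM : M.IsSymmetric) (hpos : ∀ x, x ≠ 0 → 0 < inner ℝ (M x) x) (hg : AEStronglyMeasurable g)
    {w : V} (hw : inner ℝ (M w) w < inner ℝ (P (M w)) (M w)) : g =ᵐ[volume] 0 := by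
  have hint := hgM.integrable hpos hg
  refine ae_eq_zero_of_fourier_eq_zero hint (hgM.memLp_two hpos hg) fun ξ => ?_
  obtain ⟨b, hb⟩ := hgP.forall_le (continuous_fourier hint)
  obtain ⟨C, hC⟩ := hgM.norm_fourierLine_le hM hpos
  have hF : fourierLine g ξ (M w) = 0 := by
    refine eq_zero_of_gaussian_bounds (hgM.differentiable_fourierLine hM hpos hg ξ w)
      (a := Real.pi * inner ℝ (M w) w) (q := Real.pi * inner ℝ (P (M w)) (M w))
      (m := Real.pi * (inner ℝ (P ξ) (M w) + inner ℝ (P (M w)) ξ)) (n := Real.pi * inner ℝ (P ξ) ξ)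
      (C' := b)
      (mul_nonneg Real.pi_pos.le (inner_map_self_nonneg hpos w)) (by gcongr) (hC ξ w) fun t => ?_
    rw [fourierLine_ofReal]
    refine (hb _).trans_eq ?_
    rw [gaussian]
    congr 2
    simp only [map_add, map_smul, inner_add_left, inner_add_right, real_inner_smul_left,
      real_inner_smul_right]
    ring
  rw [← fourierLine_zero g ξ (M w), hF, Pi.zero_apply]

theorem fourier_apply_map {P : V →ₗ[ℝ] V} (hgM : GaussianDecay M g) (hgP : GaussianDecay P (𝓕 g))
    (hM : M.IsSymmetric) (hpos : ∀ x, x ≠ 0 → 0 < inner ℝ (M x) x) (hg : AEStronglyMeasurable g)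
    (hMP : ∀ w, inner ℝ (P (M w)) (M w) = inner ℝ (M w) w) (w : V) :
    𝓕 g (M w) = 𝓕 g 0 * gaussian M w := by
  obtain ⟨b, hb⟩ := hgP.forall_le (continuous_fourier (hgM.integrable hpos hg))
  obtain ⟨C, hC⟩ := hgM.norm_fourierLine_le hM hpos
  have h := eq_gaussian_of_gaussian_bounds (hgM.differentiable_fourierLine hM hpos hg 0 w)
    (mul_nonneg Real.pi_pos.le (inner_map_self_nonneg hpos w)) (hC 0 w) (C' := b) (fun t => by
      rw [fourierLine_ofReal, zero_add]
      refine (hb _).trans_eq ?_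
      rw [gaussian, map_smul, real_inner_smul_left, real_inner_smul_right, hMP]
      ring_nf) (1 : ℝ)
  rw [fourierLine_ofReal, fourierLine_zero, zero_add, one_smul] at h
  rw [h, gaussian]
  push_cast
  ring_nf

end GaussianDecay

theorem fourier_gaussian_map (hM : M.IsSymmetric)
    (hpos : ∀ x, x ≠ 0 → 0 < inner ℝ (M x) x) (w : V) :
    𝓕 (fun x => (gaussian M x : ℂ)) (M w) = (∫ x, gaussian M x : ℝ) * gaussian M w := by
  set κ : ℝ := ∫ x, gaussian M x
  have himag (y : ℝ) : fourierLine (fun x => (gaussian M x : ℂ)) 0 (M w) (y * Complex.I) =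
      κ * Complex.exp (-(Real.pi * inner ℝ (M w) w * (y * Complex.I) ^ 2)) := by
    rw [mul_pow, Complex.I_sq]
    have h := congrArg Complex.ofReal (integral_gaussian_mul_exp hM w y)
    rw [← integral_complex_ofReal] at h
    refine (integral_congr_ae (.of_forall fun x => ?_)).trans (h.trans ?_)
    · simp only [inner_zero_left, Complex.ofReal_zero, zero_add]
      push_cast
      congr 2
      linear_combination (-2 * Real.pi * y * inner ℝ (M w) x : ℂ) * Complex.I_mul_I
    · simp only [κ]
      push_cast
      ring_nf
  have h := congrFun (eq_of_eq_on_imaginary_axis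
    ((gaussianDecay_gaussian M).differentiable_fourierLine hM hpos
      (Complex.continuous_ofReal.comp (continuous_gaussian M)).aestronglyMeasurable 0 w)
    (G := fun z => κ * Complex.exp (-(Real.pi * inner ℝ (M w) w * z ^ 2))) (by fun_prop) himag)
    (1 : ℝ)
  rw [fourierLine_ofReal, zero_add, one_smul] at h
  rw [h, gaussian]
  push_cast
  ring_nf

theorem GaussianDecay.ae_eq_gaussian {P : V →ₗ[ℝ] V} (hgM : GaussianDecay M g)
    (hgP : GaussianDecay P (𝓕 g)) (hM : M.IsSymmetric) (hpos : ∀ x, x ≠ 0 → 0 < inner ℝ (M x) x)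
    (hg : AEStronglyMeasurable g) (hMP : ∀ w, inner ℝ (P (M w)) (M w) = inner ℝ (M w) w) :
    g =ᵐ[volume] fun x => (∫ y, g y) / (∫ y, gaussian M y : ℝ) * gaussian M x := by
  have hg0 : 𝓕 g 0 = ∫ y, g y := by simp [Real.fourier_eq']
  rw [← hg0]
  set G : V → ℂ := fun x => (gaussian M x : ℂ)
  set κ : ℝ := ∫ y, gaussian M y
  have hκ : (κ : ℂ) ≠ 0 := Complex.ofReal_ne_zero.2
    (integral_exp_pos (integrable_gaussian hpos)).ne'
  have hGm : AEStronglyMeasurable G :=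
    (Complex.continuous_ofReal.comp (continuous_gaussian M)).aestronglyMeasurable
  have hgi := hgM.integrable hpos hg
  have hGi := (gaussianDecay_gaussian M).integrable hpos hGm
  have hsurj : Function.Surjective M := LinearMap.surjective_of_injective
    ((injective_iff_map_eq_zero M).2 fun x hx => by_contra fun h0 => (hpos x h0).ne' (by simp [hx]))
  have hdiff : g - (𝓕 g 0 / κ) • G =ᵐ[volume] 0 := by
    refine ae_eq_zero_of_fourier_eq_zero (hgi.sub (hGi.smul _))
      ((hgM.memLp_two hpos hg).sub
        (((gaussianDecay_gaussian M).memLp_two hpos hGm).const_smul _)) fun ξ => ?_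
    obtain ⟨w, rfl⟩ := hsurj ξ
    rw [fourier_sub_smul hgi hGi, hgM.fourier_apply_map hgP hM hpos hg hMP,
      fourier_gaussian_map hM hpos]
    change _ - 𝓕 g 0 / κ * (κ * _) = 0
    rw [← mul_assoc, div_mul_cancel₀ _ hκ, sub_self]
  filter_upwards [hdiff] with x hx using sub_eq_zero.1 hx

end Hardy

/-! ### Functions on a product and their slices -/

section Uniqueness

theorem integral_withDensity_ofReal {X : Type*} [MeasurableSpace X] {μ : Measure X} {ρ : X → ℝ}
    (hρ : AEMeasurable ρ μ) (h0 : ∀ x, 0 ≤ ρ x) (φ : X → ℂ) :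
    ∫ x, φ x ∂(μ.withDensity fun x => ENNReal.ofReal (ρ x)) = ∫ x, (ρ x : ℂ) * φ x ∂μ := by
  rw [integral_withDensity_eq_integral_toReal_smul₀ hρ.ennreal_ofReal
    (.of_forall fun x => ENNReal.ofReal_lt_top)]
  simp only [ENNReal.toReal_ofReal (h0 _), Complex.real_smul]

theorem ae_eq_of_fourier_density_eq {X : Type*} [NormedAddCommGroup X] [NormedSpace ℝ X]
    [FiniteDimensional ℝ X] [MeasurableSpace X] [BorelSpace X] {μ : Measure X}
    {ρ σ : X → ℝ} (hρ : Integrable ρ μ) (hσ : Integrable σ μ) (hρ0 : ∀ x, 0 ≤ ρ x)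
    (hσ0 : ∀ x, 0 ≤ σ x)
    (h : ∀ ℓ : StrongDual ℝ X, ∫ x, (ρ x : ℂ) * Complex.exp (ℓ x * Complex.I) ∂μ =
      ∫ x, (σ x : ℂ) * Complex.exp (ℓ x * Complex.I) ∂μ) : ρ =ᵐ[μ] σ := by
  have := FiniteDimensional.complete ℝ X
  have := FiniteDimensional.proper_real X
  have := isFiniteMeasure_withDensity_ofReal hρ.2
  have := isFiniteMeasure_withDensity_ofReal hσ.2
  have heq : (μ.withDensity fun x => ENNReal.ofReal (ρ x)) =
      μ.withDensity fun x => ENNReal.ofReal (σ x) := by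
    refine Measure.ext_of_charFunDual (funext fun ℓ => ?_)
    rw [charFunDual_apply, charFunDual_apply, integral_withDensity_ofReal hρ.aemeasurable hρ0,
      integral_withDensity_ofReal hσ.aemeasurable hσ0, h]
  rw [withDensity_eq_iff hρ.aemeasurable.ennreal_ofReal hσ.aemeasurable.ennreal_ofReal
    hρ.lintegral_lt_top.ne] at heq
  filter_upwards [heq] with x hx
  exact (ENNReal.ofReal_eq_ofReal_iff (hρ0 x) (hσ0 x)).1 hx

end Uniqueness

section Slices

open scoped FourierTransform

theorem exists_dual_eq_add_inner {K V : Type*} [NormedAddCommGroup K] [NormedSpace ℝ K]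
    [NormedAddCommGroup V] [InnerProductSpace ℝ V] [FiniteDimensional ℝ V]
    (L : StrongDual ℝ (K × V)) :
    ∃ (ℓ : StrongDual ℝ K) (a : V), ∀ p, L p = 2 * Real.pi * (ℓ p.1 + inner ℝ a p.2) := by
  have := FiniteDimensional.complete ℝ V
  refine ⟨(2 * Real.pi)⁻¹ • L.comp (.inl ℝ K V),
    (2 * Real.pi)⁻¹ • (InnerProductSpace.toDual ℝ V).symm (L.comp (.inr ℝ K V)), fun p => ?_⟩
  rw [real_inner_smul_left, InnerProductSpace.toDual_symm_apply, _root_.smul_apply,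
    smul_eq_mul, ← mul_add, mul_inv_cancel_left₀ Real.two_pi_pos.ne']
  exact (ContinuousLinearMap.comp_inl_add_comp_inr L p).symm

theorem ae_prod_eq_of_ae_ae_eq {X Y Z : Type*} [MeasurableSpace X] [MeasurableSpace Y]
    [TopologicalSpace Z] [TopologicalSpace.MetrizableSpace Z] {μ : Measure X} {ν : Measure Y}
    [SFinite ν] {f g : X × Y → Z} (hf : AEStronglyMeasurable f (μ.prod ν))
    (hg : AEStronglyMeasurable g (μ.prod ν)) (h : ∀ᵐ x ∂μ, ∀ᵐ y ∂ν, f (x, y) = g (x, y)) :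
    f =ᵐ[μ.prod ν] g := by
  have hmk : hf.mk f =ᵐ[μ.prod ν] hg.mk g := by
    refine (Measure.ae_prod_iff_ae_ae
      (hf.stronglyMeasurable_mk.measurableSet_eq_fun hg.stronglyMeasurable_mk)).2 ?_
    filter_upwards [h, Measure.ae_ae_of_ae_prod hf.ae_eq_mk, Measure.ae_ae_of_ae_prod hg.ae_eq_mk]
      with x hx hfx hgx
    filter_upwards [hx, hfx, hgx] with y hy hfy hgy
    rw [← hfy, hy, hgy]
  exact hf.ae_eq_mk.trans (hmk.trans hg.ae_eq_mk.symm)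

theorem memLp_two_left_of_mul {X Y : Type*} [MeasurableSpace X] [MeasurableSpace Y] {μ : Measure X}
    {ν : Measure Y} [SFinite μ] [SFinite ν] [NeZero ν] {γ : X → ℂ} {φ : Y → ℂ} (hφ : ∀ y, φ y ≠ 0)
    (h : MemLp (fun p : X × Y => γ p.1 * φ p.2) 2 (μ.prod ν))
    (hγ : AEStronglyMeasurable γ μ) : MemLp γ 2 μ := by
  obtain ⟨y, hy⟩ := ((memLp_two_iff_integrable_sq_norm h.1).1 h).prod_left_ae.exists
  refine (memLp_two_iff_integrable_sq_norm hγ).2 ((hy.mul_const (‖φ y‖ ^ 2)⁻¹).congr ?_)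
  filter_upwards with x
  rw [norm_mul, mul_pow, mul_inv_cancel_right₀ (pow_ne_zero 2 (norm_ne_zero_iff.2 (hφ y)))]

variable {K V : Type*} [MeasurableSpace K] [NormedAddCommGroup V] [InnerProductSpace ℝ V]
  [FiniteDimensional ℝ V] [MeasurableSpace V] [BorelSpace V] {κ : Measure K} {G H : K × V → ℂ}
  {M P : V →ₗ[ℝ] V}

theorem ae_eq_zero_of_slices (hM : M.IsSymmetric) (hpos : ∀ x, x ≠ 0 → 0 < inner ℝ (M x) x)
    (hG : AEStronglyMeasurable G (κ.prod volume))
    (hGM : ∀ᵐ k ∂κ, GaussianDecay M fun v => G (k, v))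
    (hGP : ∀ᵐ k ∂κ, GaussianDecay P (𝓕 fun v => G (k, v)))
    {w : V} (hw : inner ℝ (M w) w < inner ℝ (P (M w)) (M w)) : G =ᵐ[κ.prod volume] 0 := by
  refine ae_prod_eq_of_ae_ae_eq hG aestronglyMeasurable_zero ?_
  filter_upwards [hG.prodMk_left, hGM, hGP] with k hm hkM hkP
  exact hkM.ae_eq_zero hkP hM hpos hm hw

theorem exists_ae_eq_mul_gaussian_of_slices [SFinite κ] (hM : M.IsSymmetric)
    (hpos : ∀ x, x ≠ 0 → 0 < inner ℝ (M x) x) (hG : MemLp G 2 (κ.prod volume))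
    (hGM : ∀ᵐ k ∂κ, GaussianDecay M fun v => G (k, v))
    (hGP : ∀ᵐ k ∂κ, GaussianDecay P (𝓕 fun v => G (k, v)))
    (hMP : ∀ w, inner ℝ (P (M w)) (M w) = inner ℝ (M w) w) :
    ∃ γ : K → ℂ, MemLp γ 2 κ ∧ ∀ᵐ k ∂κ, ∀ᵐ v, G (k, v) = γ k * gaussian M v := by
  set γ : K → ℂ := fun k => (∫ v, G (k, v)) / (∫ y, gaussian M y : ℝ)
  have hγ : AEStronglyMeasurable γ κ := by
    simpa only [γ, div_eq_mul_inv] using hG.1.integral_prod_right'.mul_const _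
  have heq : ∀ᵐ k ∂κ, ∀ᵐ v, G (k, v) = γ k * gaussian M v := by
    filter_upwards [hG.1.prodMk_left, hGM, hGP] with k hm hkM hkP
    exact hkM.ae_eq_gaussian hkP hM hpos hm hMP
  have hgauss : Measurable fun v : V => (gaussian M v : ℂ) :=
    (Complex.continuous_ofReal.comp (continuous_gaussian M)).measurable
  refine ⟨γ, memLp_two_left_of_mul (ν := (volume : Measure V)) (φ := fun v => (gaussian M v : ℂ))
    (fun v => Complex.ofReal_ne_zero.2 (gaussian_pos M v).ne') ?_ hγ, heq⟩
  exact (memLp_congr_ae (ae_prod_eq_of_ae_ae_eq hG.1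
    (hγ.comp_fst.mul (hgauss.comp measurable_snd).aestronglyMeasurable) heq)).1 hG

/-- The Fourier transform in the second variable. -/
def partialFourier (G : K × V → ℂ) (p : K × V) : ℂ :=
  𝓕 (fun v => G (p.1, v)) p.2

variable [SFinite κ]

theorem aestronglyMeasurable_partialFourier (hG : AEStronglyMeasurable G (κ.prod volume)) :
    AEStronglyMeasurable (partialFourier G) (κ.prod volume) := by
  have hswap : Measure.QuasiMeasurePreserving (fun q : (K × V) × V => (q.1.1, q.2))
      ((κ.prod volume).prod volume) (κ.prod volume) :=
    QuasiMeasurePreserving.prodMap (f := Prod.fst) (g := id) Measure.quasiMeasurePreserving_fst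
      (.id _)
  have hexp : Measurable fun q : (K × V) × V =>
      Complex.exp (((-2 * Real.pi * inner ℝ q.2 q.1.2 : ℝ) : ℂ) * Complex.I) := by fun_prop
  rw [show partialFourier G = _ from funext fun p => Real.fourier_eq' _ _]
  exact (hexp.aestronglyMeasurable.smul
    (hG.comp_quasiMeasurePreserving hswap)).integral_prod_right'

theorem memLp_two_partialFourier (hG : MemLp G 2 (κ.prod volume))
    (hi : ∀ᵐ k ∂κ, Integrable (fun v => G (k, v)) ∧ MemLp (fun v => G (k, v)) 2) :
    MemLp (partialFourier G) 2 (κ.prod volume) := by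
  have hm := aestronglyMeasurable_partialFourier hG.1
  have hsq := (memLp_two_iff_integrable_sq_norm hG.1).1 hG
  refine (memLp_two_iff_integrable_sq_norm hm).2 ((integrable_prod_iff (hm.norm.pow 2)).2 ?_)
  refine ⟨?_, hsq.norm.integral_prod_left.congr ?_⟩
  · filter_upwards [hi] with k hk
    have := memLp_two_fourier hk.1 hk.2
    exact (memLp_two_iff_integrable_sq_norm this.1).1 this
  · filter_upwards [hi] with k hk
    simp only [norm_pow, norm_norm, Pi.pow_apply, partialFourier]
    exact (integral_norm_sq_fourier hk.1 hk.2).symm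

theorem integrable_mul_cexp {X : Type*} [MeasurableSpace X] {μ : Measure X} {φ : X → ℂ}
    (hφ : Integrable φ μ) {θ : X → ℝ} (hθ : Measurable θ) :
    Integrable (fun x => φ x * Complex.exp (2 * Real.pi * Complex.I * θ x)) μ := by
  refine hφ.mul_bdd (c := 1) (Measurable.aestronglyMeasurable (by fun_prop))
    (.of_forall fun x => ?_)
  rw [Complex.norm_exp]
  simp

theorem integral_norm_sq_partialFourier_mul_exp (hG : MemLp G 2 (κ.prod volume))
    (hi : ∀ᵐ k ∂κ, Integrable (fun v => G (k, v)) ∧ MemLp (fun v => G (k, v)) 2)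
    {ψ : K → ℝ} (hψ : Measurable ψ) (a : V) :
    ∫ p, ((‖partialFourier G p‖ ^ 2 : ℝ) : ℂ) *
        Complex.exp (2 * Real.pi * Complex.I * ((ψ p.1 + inner ℝ a p.2 : ℝ) : ℂ))
          ∂(κ.prod volume) =
      ∫ p, starRingEnd ℂ (G p) * G (p.1, p.2 + a) *
        Complex.exp (2 * Real.pi * Complex.I * (ψ p.1 : ℝ)) ∂(κ.prod volume) := by
  have hF := memLp_two_partialFourier hG hi
  have hFsq : Integrable (fun p => ((‖partialFourier G p‖ ^ 2 : ℝ) : ℂ)) (κ.prod volume) :=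
    ((memLp_two_iff_integrable_sq_norm hF.1).1 hF).ofReal
  have hshift : MeasurePreserving (fun p : K × V => (p.1, p.2 + a)) (κ.prod volume)
      (κ.prod volume) :=
    (MeasurePreserving.id _).prod (measurePreserving_add_right _ a)
  have hGG : Integrable (fun p : K × V => starRingEnd ℂ (G p) * G (p.1, p.2 + a))
      (κ.prod volume) :=
    MemLp.integrable_mul (p := 2) (q := 2) hG.star (hG.comp_measurePreserving hshift)
  rw [integral_prod _ (integrable_mul_cexp hFsq (by fun_prop)),
    integral_prod _ (integrable_mul_cexp hGG (by fun_prop))]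
  refine integral_congr_ae ?_
  filter_upwards [hi] with k hk
  rw [integral_mul_const, ← integral_norm_sq_fourier_mul_exp hk.1 hk.2 a, ← integral_mul_const]
  refine integral_congr_ae (.of_forall fun u => ?_)
  simp only [partialFourier]
  rw [Complex.ofReal_add, mul_add, Complex.exp_add]
  ring

variable [NormedAddCommGroup K] [NormedSpace ℝ K] [FiniteDimensional ℝ K] [BorelSpace K]

theorem ae_norm_eq_norm_partialFourier (hG : MemLp G 2 (κ.prod volume))
    (hH : MemLp H 2 (κ.prod volume))
    (hi : ∀ᵐ k ∂κ, Integrable (fun v => G (k, v)) ∧ MemLp (fun v => G (k, v)) 2)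
    (hid : ∀ (ℓ : StrongDual ℝ K) (a : V),
      ∫ p, ((‖H p‖ ^ 2 : ℝ) : ℂ) *
        Complex.exp (2 * Real.pi * Complex.I * ((ℓ p.1 + inner ℝ a p.2 : ℝ) : ℂ))
          ∂(κ.prod volume) =
      ∫ p, starRingEnd ℂ (G p) * G (p.1, p.2 + a) *
        Complex.exp (2 * Real.pi * Complex.I * (ℓ p.1 : ℝ)) ∂(κ.prod volume)) :
    ∀ᵐ k ∂κ, ∀ᵐ u, ‖H (k, u)‖ = ‖𝓕 (fun v => G (k, v)) u‖ := by
  have hF := memLp_two_partialFourier hG hi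
  have hsq : (fun p => ‖H p‖ ^ 2) =ᵐ[κ.prod volume] fun p => ‖partialFourier G p‖ ^ 2 := by
    refine ae_eq_of_fourier_density_eq ((memLp_two_iff_integrable_sq_norm hH.1).1 hH)
      ((memLp_two_iff_integrable_sq_norm hF.1).1 hF) (fun p => by positivity)
      (fun p => by positivity) fun L => ?_
    obtain ⟨ℓ, a, hL⟩ := exists_dual_eq_add_inner L
    have hexp (p : K × V) : Complex.exp (L p * Complex.I) =
        Complex.exp (2 * Real.pi * Complex.I * ((ℓ p.1 + inner ℝ a p.2 : ℝ) : ℂ)) := by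
      rw [hL]
      push_cast
      ring_nf
    simp only [hexp]
    rw [hid, integral_norm_sq_partialFourier_mul_exp hG hi ℓ.measurable]
  filter_upwards [Measure.ae_ae_of_ae_prod hsq] with k hk
  filter_upwards [hk] with u hu
  exact (sq_eq_sq₀ (norm_nonneg _) (norm_nonneg _)).1 hu

end Slices

/-! ### Wigner distributions and parity operators -/

section Parity

variable {d : ℕ}

theorem memLp_parity (z : Rd d × Rd d) (h : L2 d) :
    MemLp (fun y => Complex.exp (4 * Real.pi * Complex.I * (inner ℝ z.2 (y - z.1) : ℝ)) *
      h ((2 : ℝ) • z.1 - y)) 2 volume := by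
  have hm : MemLp (fun y => h ((2 : ℝ) • z.1 - y)) 2 volume :=
    (Lp.memLp h).comp_measurePreserving (Measure.measurePreserving_sub_left volume _)
  have hc : Continuous fun y : Rd d =>
      Complex.exp (4 * Real.pi * Complex.I * (inner ℝ z.2 (y - z.1) : ℝ)) := by fun_prop
  refine hm.of_le (hc.aestronglyMeasurable.mul hm.1) (.of_forall fun y => ?_)
  simp [Complex.norm_exp]

/-- The parity operator `h ↦ e^{4πi ξ·(y - x)} h(2x - y)` about the point `z = (x, ξ)` of phase
space. Up to a constant, its matrix coefficients are the values at `z` of the cross-Wigner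
distributions. -/
def parity (z : Rd d × Rd d) (h : L2 d) : L2 d :=
  (memLp_parity z h).toLp _

theorem coeFn_parity (z : Rd d × Rd d) (h : L2 d) :
    parity z h =ᵐ[volume] fun y =>
      Complex.exp (4 * Real.pi * Complex.I * (inner ℝ z.2 (y - z.1) : ℝ)) *
        h ((2 : ℝ) • z.1 - y) :=
  (memLp_parity z h).coeFn_toLp

theorem conj_exp_four_pi_mul_I (t : ℝ) :
    starRingEnd ℂ (Complex.exp (4 * Real.pi * Complex.I * t)) =
      Complex.exp (-(4 * Real.pi * Complex.I * t)) := by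
  simp [← Complex.exp_conj, map_ofNat]

theorem wigner_eq_inner_parity (h g : L2 d) (z : Rd d × Rd d) :
    wigner h g z = (2 : ℂ) ^ d * inner ℂ (parity z g) h := by
  set Φ : Rd d → ℂ := fun y => h y * starRingEnd ℂ (g ((2 : ℝ) • z.1 - y)) *
    Complex.exp (-(4 * Real.pi * Complex.I * (inner ℝ z.2 (y - z.1) : ℝ)))
  have hinner : inner ℂ (parity z g) h = ∫ y, Φ y := by
    rw [L2.inner_def]
    refine integral_congr_ae ?_
    filter_upwards [coeFn_parity z g] with y hy
    rw [hy, RCLike.inner_apply, map_mul, conj_exp_four_pi_mul_I]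
    ring
  have hwigner : wigner h g z = ∫ t : Rd d, Φ (z.1 + (2⁻¹ : ℝ) • t) := by
    refine integral_congr_ae (.of_forall fun t => ?_)
    have hreflect : (2 : ℝ) • z.1 - (z.1 + (2⁻¹ : ℝ) • t) = z.1 - (2⁻¹ : ℝ) • t := by
      rw [two_smul]
      abel
    simp only [Φ, hreflect, add_sub_cancel_left, real_inner_smul_right]
    push_cast
    ring_nf
  rw [hinner, hwigner, Measure.integral_comp_smul volume (fun t : Rd d => Φ (z.1 + t)) (2⁻¹ : ℝ),
    integral_add_left_eq_self, finrank_euclideanSpace_fin, abs_of_pos (by positivity), inv_pow,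
    inv_inv, Complex.real_smul, Complex.ofReal_pow, Complex.ofReal_ofNat]

theorem IsMetaplectic.map_parity {S : Matrix (Fin d ⊕ Fin d) (Fin d ⊕ Fin d) ℝ}
    {T : L2 d ≃ₗᵢ[ℂ] L2 d} (hT : IsMetaplectic S T) (z : Rd d × Rd d) (g : L2 d) :
    T (parity (blockAct S⁻¹ z) g) = parity z (T g) := by
  refine ext_inner_right ℂ fun v => ?_
  obtain ⟨h, rfl⟩ := T.surjective v
  have hcov := hT.covariance h g z
  rw [wigner_eq_inner_parity, wigner_eq_inner_parity] at hcov
  rw [T.inner_map_map]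
  exact (mul_left_cancel₀ (pow_ne_zero _ two_ne_zero) hcov).symm

theorem inner_parity_parity_zero (f : L2 d) (z : Rd d × Rd d) :
    inner ℂ (parity z f) (parity 0 f) = ∫ y : Rd d, starRingEnd ℂ (f y) * f (y - (2 : ℝ) • z.1) *
      Complex.exp (4 * Real.pi * Complex.I * (inner ℝ z.2 (y - z.1) : ℝ)) := by
  rw [L2.inner_def, ← integral_sub_left_eq_self (fun y : Rd d => starRingEnd ℂ (f y) *
    f (y - (2 : ℝ) • z.1) * Complex.exp (4 * Real.pi * Complex.I * (inner ℝ z.2 (y - z.1) : ℝ)))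
    volume ((2 : ℝ) • z.1)]
  refine integral_congr_ae ?_
  filter_upwards [coeFn_parity z f, coeFn_parity 0 f] with y hz h0
  have hshift : (2 : ℝ) • z.1 - y - (2 : ℝ) • z.1 = -y := by abel
  have hcentre : (2 : ℝ) • z.1 - y - z.1 = -(y - z.1) := by
    rw [two_smul]
    abel
  rw [hz, h0, RCLike.inner_apply, map_mul, conj_exp_four_pi_mul_I, hshift, hcentre,
    inner_neg_right]
  simp only [Prod.fst_zero, Prod.snd_zero, inner_zero_left, smul_zero, zero_sub,
    Complex.ofReal_zero, mul_zero, Complex.exp_zero, one_mul, Complex.ofReal_neg, mul_neg]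
  ring

theorem symplectic_inv_fromBlocks {A B C D : Matrix (Fin d) (Fin d) ℝ}
    (hS : Matrix.fromBlocks A B C D ∈ Matrix.symplecticGroup (Fin d) ℝ) :
    (Matrix.fromBlocks A B C D)⁻¹ = Matrix.fromBlocks Dᵀ (-Bᵀ) (-Cᵀ) Aᵀ := by
  rw [SymplecticGroup.inv_eq_symplectic_inv _ hS, Matrix.J, Matrix.fromBlocks_transpose,
    Matrix.fromBlocks_neg, Matrix.fromBlocks_multiply, Matrix.fromBlocks_multiply]
  simp

theorem IsMetaplectic.integral_norm_sq_mul_exp {A B C D : Matrix (Fin d) (Fin d) ℝ}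
    {T : L2 d ≃ₗᵢ[ℂ] L2 d} (hT : IsMetaplectic (Matrix.fromBlocks A B C D) T) (f : L2 d)
    (ξ : Rd d) :
    ∫ y : Rd d, ((‖T f y‖ ^ 2 : ℝ) : ℂ) *
        Complex.exp (2 * Real.pi * Complex.I * (inner ℝ ξ y : ℝ)) =
      ∫ y : Rd d, starRingEnd ℂ (f y) * f (y + act Bᵀ ξ) *
        Complex.exp (2 * Real.pi * Complex.I *
          (inner ℝ (act Aᵀ ξ) (y + (2⁻¹ : ℝ) • act Bᵀ ξ) : ℝ)) := by
  set z : Rd d × Rd d := (0, (2⁻¹ : ℝ) • ξ)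
  have hz : blockAct (Matrix.fromBlocks A B C D)⁻¹ z =
      (-((2⁻¹ : ℝ) • act Bᵀ ξ), (2⁻¹ : ℝ) • act Aᵀ ξ) := by
    rw [symplectic_inv_fromBlocks hT.symplectic]
    simp [blockAct, z]
  have h0 : blockAct (Matrix.fromBlocks A B C D)⁻¹ 0 = 0 := by simp [blockAct]
  have hcoef : inner ℂ (parity z (T f)) (parity 0 (T f)) =
      inner ℂ (parity (blockAct (Matrix.fromBlocks A B C D)⁻¹ z) f) (parity 0 f) := by
    rw [← hT.map_parity z f, ← hT.map_parity 0 f, h0, T.inner_map_map]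
  rw [inner_parity_parity_zero, inner_parity_parity_zero, hz] at hcoef
  refine Eq.trans (integral_congr_ae (.of_forall fun y => ?_))
    (hcoef.trans (integral_congr_ae (.of_forall fun y => ?_)))
  · simp only [z, smul_zero, sub_zero, real_inner_smul_left]
    rw [mul_comm (starRingEnd ℂ _), Complex.mul_conj, Complex.normSq_eq_norm_sq]
    push_cast
    ring_nf
  · simp only [smul_neg, sub_neg_eq_add, real_inner_smul_left,
      smul_inv_smul₀ (two_ne_zero' ℝ)]
    push_cast
    ring_nf

end Parity

/-! ### Eigenvalues of products of positive semidefinite matrices -/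

section LinearAlgebra

variable {d : ℕ} {E F M P : Matrix (Fin d) (Fin d) ℝ}

theorem act_mul (E F : Matrix (Fin d) (Fin d) ℝ) (x : Rd d) :
    act (E * F) x = act E (act F x) :=
  LinearMap.congr_fun (Matrix.toLpLin_mul_same _ E F) x

theorem adjoint_act (E : Matrix (Fin d) (Fin d) ℝ) : LinearMap.adjoint (act E) = act Eᵀ :=
  (Matrix.toEuclideanLin_conjTranspose_eq_adjoint E).symm

theorem inner_act_transpose (E : Matrix (Fin d) (Fin d) ℝ) (x y : Rd d) :
    inner ℝ (act Eᵀ x) y = inner ℝ x (act E y) := by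
  rw [← adjoint_act, LinearMap.adjoint_inner_left]

theorem orthogonal_kerM (E : Matrix (Fin d) (Fin d) ℝ) : (kerM E)ᗮ = ranM Eᵀ := by
  rw [kerM, LinearMap.orthogonal_ker, adjoint_act]

theorem orthogonal_kerM_of_isHermitian (hE : E.IsHermitian) : (kerM E)ᗮ = ranM E := by
  rw [orthogonal_kerM, ← Matrix.conjTranspose_eq_transpose_of_trivial, hE.eq]

theorem rank_eq_of_kerM_eq (h : kerM E = kerM F) : E.rank = F.rank := by
  have hE := LinearMap.finrank_range_add_finrank_ker (act E)
  have hF := LinearMap.finrank_range_add_finrank_ker (act F)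
  rw [show LinearMap.ker (act E) = LinearMap.ker (act F) from h] at hE
  have hrank (G : Matrix (Fin d) (Fin d) ℝ) :
      G.rank = Module.finrank ℝ (LinearMap.range (act G)) :=
    G.rank_eq_finrank_range_toLin (EuclideanSpace.basisFun (Fin d) ℝ).toBasis
      (EuclideanSpace.basisFun (Fin d) ℝ).toBasis
  rw [hrank, hrank]
  omega

theorem inner_act_self (E : Matrix (Fin d) (Fin d) ℝ) (x : Rd d) :
    inner ℝ (act E x) x = star x.ofLp ⬝ᵥ E *ᵥ x.ofLp := by
  rw [EuclideanSpace.inner_eq_star_dotProduct, Matrix.ofLp_toLpLin, Matrix.toLin'_apply,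
    star_trivial, star_trivial]

theorem inner_act_self_nonneg (hE : E.PosSemidef) (x : Rd d) : 0 ≤ inner ℝ (act E x) x := by
  rw [inner_act_self]
  exact hE.dotProduct_mulVec_nonneg _

theorem inner_act_self_eq_zero_iff (hE : E.PosSemidef) {x : Rd d} :
    inner ℝ (act E x) x = 0 ↔ act E x = 0 := by
  rw [inner_act_self, hE.dotProduct_mulVec_zero_iff, Matrix.toLpLin_apply,
    WithLp.toLp_eq_zero]

theorem act_transpose_mul_mul_eq_zero_iff (hP : P.PosSemidef) {x : Rd d} :
    act (Eᵀ * P * E) x = 0 ↔ act P (act E x) = 0 := by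
  refine ⟨fun h => (inner_act_self_eq_zero_iff hP).1 ?_, fun h => ?_⟩
  · rw [← inner_act_transpose, ← act_mul, ← act_mul, h, inner_zero_left]
  · rw [act_mul, act_mul, h, map_zero]

theorem kerM_transpose_mul_mul (hP : P.PosSemidef) (hPE : ranM P = ranM E) :
    kerM (Eᵀ * P * E) = kerM E := by
  have hdisj : Disjoint (ranM E) (kerM P) := by
    rw [← hPE, ← orthogonal_kerM_of_isHermitian hP.isHermitian]
    exact (kerM P).orthogonal_disjoint.symm
  ext x
  rw [LinearMap.mem_ker, LinearMap.mem_ker, act_transpose_mul_mul_eq_zero_iff hP]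
  exact ⟨fun h => Submodule.disjoint_def.1 hdisj _ ⟨x, rfl⟩ h, fun h => by rw [h, map_zero]⟩

theorem exists_isHermitian_mul_self (hM : M.PosSemidef) :
    ∃ R : Matrix (Fin d) (Fin d) ℝ, Rᵀ = R ∧ R * R = M := by
  open scoped MatrixOrder in
  exact ⟨CFC.sqrt M, (Matrix.nonneg_iff_posSemidef.1 (CFC.sqrt_nonneg M)).isHermitian,
    CFC.sqrt_mul_sqrt_self M hM.nonneg⟩

variable {R : Matrix (Fin d) (Fin d) ℝ}

theorem kerM_mul_self (hR : Rᵀ = R) : kerM (R * R) = kerM R := by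
  ext x
  have h := act_transpose_mul_mul_eq_zero_iff (E := R) (x := x) Matrix.PosSemidef.one
  rwa [hR, Matrix.mul_one, ← act_mul, Matrix.one_mul] at h

theorem isHermitian_conj (hR : Rᵀ = R) (hP : P.IsHermitian) : (R * P * R).IsHermitian := by
  have h := Matrix.isHermitian_mul_mul_conjTranspose R hP
  rwa [Matrix.conjTranspose_eq_transpose_of_trivial, hR] at h

theorem kerM_conj (hR : Rᵀ = R) (hP : P.PosSemidef) (hker : kerM (R * R) = kerM P) :
    kerM (R * P * R) = kerM R := by
  ext x
  have h (y : Rd d) : act P y = 0 ↔ act R y = 0 := by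
    rw [← LinearMap.mem_ker, ← LinearMap.mem_ker (f := act R)]
    exact SetLike.ext_iff.1 (hker.symm.trans (kerM_mul_self hR)) y
  have h2 := act_transpose_mul_mul_eq_zero_iff (E := R) (x := x) hP
  rw [hR, h, ← act_mul] at h2
  rw [LinearMap.mem_ker, h2, ← LinearMap.mem_ker (f := act (R * R)), ← kerM_mul_self hR]

theorem nonzeroEigenvalues_mul_self_mul (h : (R * P * R).IsHermitian) :
    nonzeroEigenvalues (R * R * P) =
      (Finset.univ.val.map h.eigenvalues).filter (fun t => t ≠ 0) := by
  rw [nonzeroEigenvalues, Matrix.mul_assoc, Matrix.charpoly_mul_comm,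
    h.roots_charpoly_eq_eigenvalues]
  rfl

theorem card_nonzeroEigenvalues_mul (hM : M.PosSemidef) (hP : P.PosSemidef)
    (hker : kerM M = kerM P) : (nonzeroEigenvalues (M * P)).card = P.rank := by
  obtain ⟨R, hR, rfl⟩ := exists_isHermitian_mul_self hM
  have hG := isHermitian_conj hR hP.isHermitian
  have hrank : P.rank = (R * P * R).rank := rank_eq_of_kerM_eq <| by
    rw [kerM_conj hR hP hker, ← hker, kerM_mul_self hR]
  rw [nonzeroEigenvalues_mul_self_mul hG, hrank, hG.rank_eq_card_non_zero_eigs,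
    Multiset.filter_map, Multiset.card_map, Fintype.card_subtype]
  rfl

theorem exists_act_eq_smul_of_mem_nonzeroEigenvalues {μ : ℝ} (hμ : μ ∈ nonzeroEigenvalues E) :
    ∃ u : Rd d, u ≠ 0 ∧ act E u = μ • u := by
  have hspec : μ ∈ spectrum ℝ (act E) := by
    rw [Matrix.spectrum_toLpLin, Matrix.mem_spectrum_iff_isRoot_charpoly]
    exact Polynomial.isRoot_of_mem_roots (Multiset.mem_filter.1 hμ).1
  obtain ⟨u, hu⟩ := (Module.End.hasEigenvalue_iff_mem_spectrum.2 hspec).exists_hasEigenvector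
  exact ⟨u, hu.2, hu.apply_eq_smul⟩

theorem le_one_of_mem_nonzeroEigenvalues_mul (hP : P.PosSemidef)
    (hle : ∀ w ∈ (kerM P)ᗮ, inner ℝ (act P (act M w)) (act M w) ≤ inner ℝ (act M w) w)
    {μ : ℝ} (hμ : μ ∈ nonzeroEigenvalues (M * P)) : μ ≤ 1 := by
  obtain ⟨u, hu, hMPu⟩ := exists_act_eq_smul_of_mem_nonzeroEigenvalues hμ
  rw [act_mul] at hMPu
  have hquad : 0 < inner ℝ (act P u) u := by
    refine (inner_act_self_nonneg hP u).lt_of_ne' fun h => ?_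
    rw [(inner_act_self_eq_zero_iff hP).1 h, map_zero] at hMPu
    exact (smul_ne_zero (Multiset.mem_filter.1 hμ).2 hu) hMPu.symm
  have hmem : act P u ∈ (kerM P)ᗮ :=
    orthogonal_kerM_of_isHermitian hP.isHermitian ▸ ⟨u, rfl⟩
  have h := hle (act P u) hmem
  rw [hMPu, map_smul, real_inner_smul_left, real_inner_smul_right, real_inner_smul_left,
    real_inner_comm (act P u) u] at h
  by_contra! hlt
  nlinarith [mul_pos (sub_pos.2 hlt) (mul_pos (one_pos.trans hlt) hquad)]

theorem act_eigenvectorBasis (hE : E.IsHermitian) (i : Fin d) :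
    act E (hE.eigenvectorBasis i) = hE.eigenvalues i • hE.eigenvectorBasis i := by
  rw [Matrix.toLpLin_apply, hE.mulVec_eigenvectorBasis]
  rfl

theorem mul_mul_eq_self_of_nonzeroEigenvalues_eq_one (hM : M.PosSemidef) (hP : P.PosSemidef)
    (hker : kerM M = kerM P) (hone : ∀ μ ∈ nonzeroEigenvalues (M * P), μ = 1) :
    M * P * M = M := by
  obtain ⟨R, hR, rfl⟩ := exists_isHermitian_mul_self hM
  have hG := isHermitian_conj hR hP.isHermitian
  have hfix : R * (R * P * R) = R := by
    refine Matrix.toEuclideanLin.injective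
      (hG.eigenvectorBasis.toBasis.ext fun i => ?_)
    rw [OrthonormalBasis.coe_toBasis, act_mul, act_eigenvectorBasis]
    by_cases h0 : hG.eigenvalues i = 0
    · have hmem : hG.eigenvectorBasis i ∈ kerM (R * P * R) := by
        rw [LinearMap.mem_ker, act_eigenvectorBasis, h0, zero_smul]
      rw [kerM_conj hR hP hker, LinearMap.mem_ker] at hmem
      rw [h0, zero_smul, map_zero, hmem]
    · rw [hone (hG.eigenvalues i), one_smul]
      rw [nonzeroEigenvalues_mul_self_mul hG, Multiset.mem_filter]
      exact ⟨Multiset.mem_map_of_mem _ (Finset.mem_univ i), h0⟩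
  calc R * R * P * (R * R) = R * (R * P * R) * R := by simp only [Matrix.mul_assoc]
    _ = R * R := by rw [hfix]

end LinearAlgebra

/-! ### Symplectic coordinates -/

section Coordinates

variable {d : ℕ} {A B C D : Matrix (Fin d) (Fin d) ℝ}

instance isAddHaarMeasure_leb (W : Submodule ℝ (Rd d)) : (leb W).IsAddHaarMeasure := by
  unfold leb
  infer_instance

theorem act_transpose_mem_orthogonal_kerM (B : Matrix (Fin d) (Fin d) ℝ) (x : Rd d) :
    act Bᵀ x ∈ (kerM B)ᗮ := by
  rw [orthogonal_kerM]
  exact ⟨x, rfl⟩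

theorem act_one_add_mul (E F : Matrix (Fin d) (Fin d) ℝ) (x : Rd d) :
    act (1 + E * F) x = x + act E (act F x) := by
  rw [act, map_add, LinearMap.add_apply, Matrix.toLpLin_one, act_mul]
  rfl

theorem symplectic_relations
    (hS : Matrix.fromBlocks A B C D ∈ Matrix.symplecticGroup (Fin d) ℝ) :
    Dᵀ * B = Bᵀ * D ∧ Dᵀ * A = 1 + Bᵀ * C ∧ B * Aᵀ = A * Bᵀ ∧ A * Dᵀ = 1 + B * Cᵀ := by
  have hS' := SymplecticGroup.transpose_mem hS
  rw [Matrix.fromBlocks_transpose] at hS'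
  obtain ⟨-, hBD, hAD⟩ := SymplecticGroup.fromBlocks_mem_iff.1 hS
  obtain ⟨hAB, -, hAD'⟩ := SymplecticGroup.fromBlocks_mem_iff.1 hS'
  simp only [Matrix.transpose_transpose] at hAB hAD'
  refine ⟨hBD.symm, ?_, hAB.symm, sub_eq_iff_eq_add.1 hAD'⟩
  simpa [Matrix.transpose_mul] using congrArg Matrix.transpose (sub_eq_iff_eq_add.1 hAD)

/-- The isomorphism `W × Wᗮ ≃ ℝᵈ`, `(k, v) ↦ φ k + ψ v`, for `φ` and `ψ` injective with independent
ranges. -/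
def prodOrthogonalEquiv (W : Submodule ℝ (Rd d)) (φ : W →ₗ[ℝ] Rd d) (ψ : Wᗮ →ₗ[ℝ] Rd d)
    (h : ∀ k v, φ k + ψ v = 0 → k = 0 ∧ v = 0) : (W × Wᗮ) ≃L[ℝ] Rd d :=
  ((φ.coprod ψ).linearEquivOfInjective
    ((injective_iff_map_eq_zero _).2 fun p hp => Prod.ext_iff.2 (h p.1 p.2 hp))
    (by rw [Module.finrank_prod, W.finrank_add_finrank_orthogonal])).toContinuousLinearEquiv

theorem eq_zero_of_add_mem_orthogonal {W : Submodule ℝ (Rd d)} {k v : Rd d} (hk : k ∈ W)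
    (hv : v ∈ Wᗮ) (h : k + v ∈ Wᗮ) : k = 0 :=
  Submodule.disjoint_def.1 W.orthogonal_disjoint k hk ((Submodule.add_mem_iff_left _ hv).1 h)

theorem eq_zero_of_act_transpose_mul_add_eq_zero
    (hS : Matrix.fromBlocks A B C D ∈ Matrix.symplecticGroup (Fin d) ℝ) (k : kerM B)
    (v : (kerM B)ᗮ) (h : act (Dᵀ * A) (k : Rd d) + v = 0) : k = 0 ∧ v = 0 := by
  have hk : k = 0 := by
    refine Subtype.ext (eq_zero_of_add_mem_orthogonal k.2
      (add_mem (act_transpose_mem_orthogonal_kerM B (act C k)) v.2) ?_)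
    rw [← add_assoc, ← act_one_add_mul, ← (symplectic_relations hS).2.1, h]
    exact zero_mem _
  subst hk
  exact ⟨rfl, by simpa using h⟩

theorem eq_zero_of_act_add_act_eq_zero
    (hS : Matrix.fromBlocks A B C D ∈ Matrix.symplecticGroup (Fin d) ℝ) (k : kerM B)
    (u : (kerM B)ᗮ) (h : act A (k : Rd d) + act B u = 0) : k = 0 ∧ u = 0 := by
  have hk : k = 0 := by
    refine (eq_zero_of_act_transpose_mul_add_eq_zero hS k
      ⟨_, act_transpose_mem_orthogonal_kerM B (act D u)⟩ ?_).1
    have hBD : act Bᵀ (act D u) = act Dᵀ (act B u) := by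
      rw [← act_mul, ← (symplectic_relations hS).1, act_mul]
    simp only [hBD, act_mul, ← map_add, h, map_zero]
  subst hk
  rw [ZeroMemClass.coe_zero, map_zero, zero_add] at h
  exact ⟨rfl, Subtype.ext (Submodule.disjoint_def.1 (kerM B).orthogonal_disjoint _ h u.2)⟩

/-- The coordinates `x = Dᵀ A k + v` of `ℝᵈ`, with `k ∈ ker B` and `v ∈ (ker B)ᗮ`. -/
def decayCoord (hS : Matrix.fromBlocks A B C D ∈ Matrix.symplecticGroup (Fin d) ℝ) :
    (kerM B × (kerM B)ᗮ) ≃L[ℝ] Rd d :=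
  prodOrthogonalEquiv (kerM B) (act (Dᵀ * A) ∘ₗ (kerM B).subtype) (kerM B)ᗮ.subtype
    (eq_zero_of_act_transpose_mul_add_eq_zero hS)

theorem decayCoord_apply (hS : Matrix.fromBlocks A B C D ∈ Matrix.symplecticGroup (Fin d) ℝ)
    (p : kerM B × (kerM B)ᗮ) : decayCoord hS p = act (Dᵀ * A) p.1 + p.2 :=
  rfl

/-- The coordinates `ξ = A k + B u` of `ℝᵈ`, with `k ∈ ker B` and `u ∈ (ker B)ᗮ`. -/
def rangeCoord (hS : Matrix.fromBlocks A B C D ∈ Matrix.symplecticGroup (Fin d) ℝ) :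
    (kerM B × (kerM B)ᗮ) ≃L[ℝ] Rd d :=
  prodOrthogonalEquiv (kerM B) (act A ∘ₗ (kerM B).subtype) (act B ∘ₗ (kerM B)ᗮ.subtype)
    (eq_zero_of_act_add_act_eq_zero hS)

theorem rangeCoord_apply (hS : Matrix.fromBlocks A B C D ∈ Matrix.symplecticGroup (Fin d) ℝ)
    (p : kerM B × (kerM B)ᗮ) : rangeCoord hS p = act A p.1 + act B p.2 :=
  rfl

theorem exists_inner_rangeCoord
    (hS : Matrix.fromBlocks A B C D ∈ Matrix.symplecticGroup (Fin d) ℝ)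
    (ℓ : StrongDual ℝ (kerM B)) (a : (kerM B)ᗮ) :
    ∃ ξ : Rd d, ∀ p, inner ℝ ξ (rangeCoord hS p) = ℓ p.1 + inner ℝ a p.2 := by
  refine ⟨(InnerProductSpace.toDual ℝ (Rd d)).symm
    ((ℓ.coprod (innerSL ℝ a)).comp (rangeCoord hS).symm.toContinuousLinearMap), fun p => ?_⟩
  rw [InnerProductSpace.toDual_symm_apply]
  simp

theorem inner_act_eq_of_inner_rangeCoord
    {hS : Matrix.fromBlocks A B C D ∈ Matrix.symplecticGroup (Fin d) ℝ}
    {ℓ : StrongDual ℝ (kerM B)} {a : (kerM B)ᗮ} {ξ : Rd d}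
    (hξ : ∀ p, inner ℝ ξ (rangeCoord hS p) = ℓ p.1 + inner ℝ a p.2) (k : kerM B) :
    inner ℝ ξ (act A k) = ℓ k := by
  simpa [rangeCoord_apply] using hξ (k, 0)

theorem act_transpose_eq_of_inner_rangeCoord
    {hS : Matrix.fromBlocks A B C D ∈ Matrix.symplecticGroup (Fin d) ℝ}
    {ℓ : StrongDual ℝ (kerM B)} {a : (kerM B)ᗮ} {ξ : Rd d}
    (hξ : ∀ p, inner ℝ ξ (rangeCoord hS p) = ℓ p.1 + inner ℝ a p.2) : act Bᵀ ξ = a := by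
  suffices h : (⟨act Bᵀ ξ, act_transpose_mem_orthogonal_kerM B ξ⟩ : (kerM B)ᗮ) = a from
    congrArg Subtype.val h
  refine ext_inner_right ℝ fun u => ?_
  have h := hξ (0, u)
  rw [rangeCoord_apply, ZeroMemClass.coe_zero, map_zero, map_zero, zero_add, zero_add] at h
  rw [← h]
  exact inner_act_transpose B ξ u

theorem act_pinv {y : Rd d} (hy : y ∈ ranM B) : act B (pinv B y) = y := by
  set e := (act B).kerComplementEquivRange (kerM B).isCompl_orthogonal.symm
  calc act B (pinv B y) = (e (e.symm ((ranM B).orthogonalProjectionOnto y)) : Rd d) := rfl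
    _ = y := by
      rw [LinearEquiv.apply_symm_apply]
      exact congrArg Subtype.val ((ranM B).orthogonalProjectionOnto_mem_subspace_eq_self ⟨y, hy⟩)

theorem inner_pinv_act_transpose (hAB : B * Aᵀ = A * Bᵀ) {v : Rd d} (hv : v ∈ (kerM B)ᗮ)
    (ξ : Rd d) : inner ℝ (pinv B (act A v)) (act Bᵀ ξ) = inner ℝ (act Aᵀ ξ) v := by
  have hAv : act A v ∈ ranM B := by
    rw [orthogonal_kerM] at hv
    obtain ⟨y, rfl⟩ := hv
    exact ⟨act Aᵀ y, by rw [← act_mul, hAB, act_mul]⟩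
  rw [real_inner_comm, inner_act_transpose, act_pinv hAv, inner_act_transpose]

theorem inner_pinv_act_comm (hAB : B * Aᵀ = A * Bᵀ) {v w : Rd d} (hv : v ∈ (kerM B)ᗮ)
    (hw : w ∈ (kerM B)ᗮ) :
    inner ℝ (pinv B (act A v)) w = inner ℝ (pinv B (act A w)) v := by
  rw [orthogonal_kerM] at hv hw
  obtain ⟨⟨x, rfl⟩, ⟨y, rfl⟩⟩ := And.intro hv hw
  rw [inner_pinv_act_transpose hAB (act_transpose_mem_orthogonal_kerM B x),
    inner_pinv_act_transpose hAB (act_transpose_mem_orthogonal_kerM B y), inner_act_transpose,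
    ← act_mul, ← hAB, act_mul, ← inner_act_transpose, real_inner_comm]

/-- The quadratic phase for which `e^{iπ chirp}` is the chirp that a slice `v ↦ f (Dᵀ A k + v)` has
to be multiplied by for its Fourier transform to have, up to a constant, the modulus of a slice of
the metaplectic image of `f`. -/
def chirp (A C : Matrix (Fin d) (Fin d) ℝ) (p : kerM B × (kerM B)ᗮ) : ℝ :=
  inner ℝ (pinv B (act A p.2)) (p.2 : Rd d) + 2 * inner ℝ (act (Cᵀ * A) p.1) (p.2 : Rd d)

theorem continuous_chirp : Continuous (chirp A C : kerM B × (kerM B)ᗮ → ℝ) := by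
  have h1 : Continuous (pinv B ∘ₗ act A) := LinearMap.continuous_of_finiteDimensional _
  have h2 : Continuous (act (Cᵀ * A)) := LinearMap.continuous_of_finiteDimensional _
  have h3 : Continuous fun p : kerM B × (kerM B)ᗮ => (p.2 : Rd d) := by fun_prop
  exact ((h1.comp h3).inner h3).add
    (continuous_const.mul ((h2.comp (continuous_subtype_val.comp continuous_fst)).inner h3))

theorem chirp_add_sub_chirp (hS : Matrix.fromBlocks A B C D ∈ Matrix.symplecticGroup (Fin d) ℝ)
    (k : kerM B) (v a : (kerM B)ᗮ) {ξ : Rd d} (ha : act Bᵀ ξ = a) :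
    chirp A C (k, v + a) - chirp A C (k, v) + 2 * inner ℝ ξ (act A k) =
      2 * inner ℝ (act Aᵀ ξ) (decayCoord hS (k, v) + (2⁻¹ : ℝ) • (a : Rd d)) := by
  obtain ⟨-, -, hAB, hAD⟩ := symplectic_relations hS
  have hav : inner ℝ (pinv B (act A a)) (v : Rd d) = inner ℝ (act Aᵀ ξ) (v : Rd d) := by
    rw [inner_pinv_act_comm hAB a.2 v.2, ← ha, inner_pinv_act_transpose hAB v.2]
  have hva : inner ℝ (pinv B (act A v)) (a : Rd d) = inner ℝ (act Aᵀ ξ) (v : Rd d) := by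
    rw [inner_pinv_act_comm hAB v.2 a.2, hav]
  have haa : inner ℝ (pinv B (act A a)) (a : Rd d) = inner ℝ (act Aᵀ ξ) (a : Rd d) := by
    nth_rw 2 [← ha]
    exact inner_pinv_act_transpose hAB a.2 ξ
  have hk : inner ℝ (act Aᵀ ξ) (act (Dᵀ * A) k) =
      inner ℝ ξ (act A k) + inner ℝ (act (Cᵀ * A) k) (a : Rd d) := by
    rw [inner_act_transpose, act_mul, ← act_mul A, hAD, act_one_add_mul, inner_add_right,
      ← inner_act_transpose B, ha, act_mul, real_inner_comm (a : Rd d)]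
  simp only [chirp, decayCoord_apply, Submodule.coe_add, map_add, inner_add_left,
    inner_add_right, real_inner_smul_right, hav, hva, haa, hk]
  ring

theorem norm_exp_pi_mul_I (t : ℝ) : ‖Complex.exp (Real.pi * Complex.I * t)‖ = 1 := by
  simp [Complex.norm_exp]

theorem ae_map_of_injOn (W : Submodule ℝ (Rd d)) (φ : Rd d →ₗ[ℝ] Rd d)
    (hφ : ∀ k : W, φ k = 0 → k = 0) {p : W.map φ → Prop} (h : ∀ᵐ x ∂leb (W.map φ), p x) :
    ∀ᵐ k : W ∂leb W, p ⟨φ k, Submodule.mem_map_of_mem k.2⟩ := by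
  have hinj : Function.Injective (φ.submoduleMap W) :=
    (injective_iff_map_eq_zero _).2 fun k hk => hφ k (congrArg Subtype.val hk)
  exact (quasiMeasurePreserving_linearEquiv (LinearEquiv.ofBijective (φ.submoduleMap W)
    ⟨hinj, φ.submoduleMap_surjective W⟩).toContinuousLinearEquiv (leb W) (leb (W.map φ))).ae h

theorem ae_ranM {p : ranM B → Prop} (h : ∀ᵐ x ∂leb (ranM B), p x) :
    ∀ᵐ u : (kerM B)ᗮ ∂leb (kerM B)ᗮ, p ⟨act B u, ⟨u, rfl⟩⟩ :=
  (quasiMeasurePreserving_linearEquiv ((act B).kerComplementEquivRange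
    (kerM B).isCompl_orthogonal.symm).toContinuousLinearEquiv _ _).ae h

end Coordinates

section Chirped

open scoped FourierTransform

variable {d : ℕ} {A B C D : Matrix (Fin d) (Fin d) ℝ}

/-- `f` in the coordinates `(k, v)`, multiplied by the chirp `e^{iπ chirp}`. -/
def chirped (hS : Matrix.fromBlocks A B C D ∈ Matrix.symplecticGroup (Fin d) ℝ) (f : L2 d)
    (p : kerM B × (kerM B)ᗮ) : ℂ :=
  f (decayCoord hS p) * Complex.exp (Real.pi * Complex.I * chirp A C p)

theorem norm_chirped (hS : Matrix.fromBlocks A B C D ∈ Matrix.symplecticGroup (Fin d) ℝ)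
    (f : L2 d) (p : kerM B × (kerM B)ᗮ) : ‖chirped hS f p‖ = ‖f (decayCoord hS p)‖ := by
  rw [chirped, norm_mul, norm_exp_pi_mul_I, mul_one]

theorem memLp_two_chirped (hS : Matrix.fromBlocks A B C D ∈ Matrix.symplecticGroup (Fin d) ℝ)
    (f : L2 d) : MemLp (chirped hS f) 2 ((leb (kerM B)).prod (leb (kerM B)ᗮ)) := by
  have hf : MemLp (fun p => f (decayCoord hS p)) 2 ((leb (kerM B)).prod (leb (kerM B)ᗮ)) :=
    memLp_comp_linearEquiv _ (Lp.memLp f)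
  have hchirp := continuous_chirp (A := A) (B := B) (C := C)
  refine hf.of_le (hf.1.mul (Continuous.aestronglyMeasurable (by fun_prop)))
    (.of_forall fun p => (norm_chirped hS f p).le)

theorem conj_chirped_mul_chirped
    (hS : Matrix.fromBlocks A B C D ∈ Matrix.symplecticGroup (Fin d) ℝ) (f : L2 d)
    (p : kerM B × (kerM B)ᗮ) {a : (kerM B)ᗮ} {ξ : Rd d} (ha : act Bᵀ ξ = a) :
    starRingEnd ℂ (chirped hS f p) * chirped hS f (p.1, p.2 + a) *
        Complex.exp (2 * Real.pi * Complex.I * (inner ℝ ξ (act A p.1) : ℝ)) =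
      starRingEnd ℂ (f (decayCoord hS p)) * f (decayCoord hS p + a) *
        Complex.exp (2 * Real.pi * Complex.I *
          (inner ℝ (act Aᵀ ξ) (decayCoord hS p + (2⁻¹ : ℝ) • (a : Rd d)) : ℝ)) := by
  have hadd : decayCoord hS (p.1, p.2 + a) = decayCoord hS p + a := by
    rw [decayCoord_apply, decayCoord_apply, Submodule.coe_add, add_assoc]
  have hconj : starRingEnd ℂ (Complex.exp (Real.pi * Complex.I * chirp A C p)) =
      Complex.exp (-(Real.pi * Complex.I * chirp A C p)) := by
    simp [← Complex.exp_conj]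
  have hphase := congrArg Complex.ofReal (chirp_add_sub_chirp hS p.1 p.2 a ha)
  push_cast at hphase
  rw [chirped, chirped, hadd, map_mul, hconj,
    show ∀ x y z w t : ℂ, (x * y) * (z * w) * t = x * z * (y * w * t) by intros; ring,
    ← Complex.exp_add, ← Complex.exp_add]
  congr 2
  linear_combination (Real.pi : ℂ) * Complex.I * hphase

theorem IsMetaplectic.exists_integral_norm_sq_slices {T : L2 d ≃ₗᵢ[ℂ] L2 d}
    (hT : IsMetaplectic (Matrix.fromBlocks A B C D) T) (f : L2 d) :
    ∃ c : ℂ, ∀ (ℓ : StrongDual ℝ (kerM B)) (a : (kerM B)ᗮ),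
      ∫ p, ((‖c * T f (rangeCoord hT.symplectic p)‖ ^ 2 : ℝ) : ℂ) *
        Complex.exp (2 * Real.pi * Complex.I * ((ℓ p.1 + inner ℝ a p.2 : ℝ) : ℂ))
          ∂(leb (kerM B)).prod (leb (kerM B)ᗮ) =
      ∫ p, starRingEnd ℂ (chirped hT.symplectic f p) *
        chirped hT.symplectic f (p.1, p.2 + a) *
        Complex.exp (2 * Real.pi * Complex.I * (ℓ p.1 : ℝ))
          ∂(leb (kerM B)).prod (leb (kerM B)ᗮ) := by
  set κ := (leb (kerM B)).prod (leb (kerM B)ᗮ)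
  obtain ⟨c₁, hc₁, h₁⟩ := exists_integral_comp_linearEquiv (decayCoord hT.symplectic) κ volume
  obtain ⟨c₂, hc₂, h₂⟩ := exists_integral_comp_linearEquiv (rangeCoord hT.symplectic) κ volume
  have hc : 0 ≤ c₁ / c₂ := (div_pos hc₁ hc₂).le
  refine ⟨(√(c₁ / c₂) : ℝ), fun ℓ a => ?_⟩
  obtain ⟨ξ, hξ⟩ := exists_inner_rangeCoord hT.symplectic ℓ a
  have ha := act_transpose_eq_of_inner_rangeCoord hξ
  calc _ = ((c₁ / c₂ : ℝ) : ℂ) * ∫ p, ((‖T f (rangeCoord hT.symplectic p)‖ ^ 2 : ℝ) : ℂ) *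
        Complex.exp (2 * Real.pi * Complex.I *
          (inner ℝ ξ (rangeCoord hT.symplectic p) : ℝ)) ∂κ := by
        rw [← integral_const_mul]
        refine integral_congr_ae (.of_forall fun p => ?_)
        simp only [hξ, norm_mul, mul_pow, Complex.norm_real, Real.norm_eq_abs, sq_abs,
          Real.sq_sqrt hc]
        push_cast
        ring
    _ = c₁ * ∫ y : Rd d, starRingEnd ℂ (f y) * f (y + act Bᵀ ξ) * Complex.exp (2 * Real.pi *
        Complex.I * (inner ℝ (act Aᵀ ξ) (y + (2⁻¹ : ℝ) • act Bᵀ ξ) : ℝ)) := by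
        rw [h₂ fun y => ((‖T f y‖ ^ 2 : ℝ) : ℂ) *
            Complex.exp (2 * Real.pi * Complex.I * (inner ℝ ξ y : ℝ)),
          hT.integral_norm_sq_mul_exp, ← mul_assoc, ← Complex.ofReal_mul,
          div_mul_cancel₀ _ hc₂.ne']
    _ = _ := by
        rw [← h₁]
        refine integral_congr_ae (.of_forall fun p => ?_)
        simp only [ha, ← inner_act_eq_of_inner_rangeCoord hξ, conj_chirped_mul_chirped _ f p ha]

variable {T : L2 d ≃ₗᵢ[ℂ] L2 d} {M P : (kerM B)ᗮ →ₗ[ℝ] (kerM B)ᗮ} {f : L2 d}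

theorem gaussianDecay_chirped
    {hS : Matrix.fromBlocks A B C D ∈ Matrix.symplecticGroup (Fin d) ℝ} {k : kerM B}
    (h : GaussianDecay M fun v => f (decayCoord hS (k, v))) :
    GaussianDecay M fun v => chirped hS f (k, v) := by
  simpa only [GaussianDecay, norm_chirped] using h

theorem IsMetaplectic.gaussianDecay_fourier_chirped
    (hT : IsMetaplectic (Matrix.fromBlocks A B C D) T)
    (hpos : ∀ x, x ≠ 0 → 0 < inner ℝ (M x) x)
    (hfM : ∀ᵐ k ∂leb (kerM B), GaussianDecay M fun v => f (decayCoord hT.symplectic (k, v)))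
    (hTfP : ∀ᵐ k ∂leb (kerM B), GaussianDecay P fun u => T f (rangeCoord hT.symplectic (k, u))) :
    ∀ᵐ k ∂leb (kerM B), GaussianDecay P (𝓕 fun v => chirped hT.symplectic f (k, v)) := by
  obtain ⟨c, hid⟩ := hT.exists_integral_norm_sq_slices f
  have hG := memLp_two_chirped hT.symplectic f
  have hH : MemLp (fun p => c * T f (rangeCoord hT.symplectic p)) 2
      ((leb (kerM B)).prod (leb (kerM B)ᗮ)) :=
    (memLp_comp_linearEquiv _ (Lp.memLp (T f))).const_mul c
  have hi : ∀ᵐ k ∂leb (kerM B),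
      Integrable (fun v => chirped hT.symplectic f (k, v)) (leb (kerM B)ᗮ) ∧
        MemLp (fun v => chirped hT.symplectic f (k, v)) 2 (leb (kerM B)ᗮ) := by
    filter_upwards [hG.1.prodMk_left, hfM] with k hk hkM
    have hkM' := gaussianDecay_chirped hkM
    exact ⟨hkM'.integrable hpos hk, hkM'.memLp_two hpos hk⟩
  filter_upwards [ae_norm_eq_norm_partialFourier hG hH hi hid, hTfP] with k hk hkP
  obtain ⟨b, hb⟩ := hkP
  refine ⟨‖c‖ * b, ?_⟩
  filter_upwards [hk, hb] with u hu hbu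
  rw [← hu, norm_mul, mul_assoc]
  exact mul_le_mul_of_nonneg_left hbu (norm_nonneg c)

theorem IsMetaplectic.inner_le_of_gaussianDecay_slices
    (hT : IsMetaplectic (Matrix.fromBlocks A B C D) T) (hM : M.IsSymmetric)
    (hpos : ∀ x, x ≠ 0 → 0 < inner ℝ (M x) x) (hf : f ≠ 0)
    (hfM : ∀ᵐ k ∂leb (kerM B), GaussianDecay M fun v => f (decayCoord hT.symplectic (k, v)))
    (hTfP : ∀ᵐ k ∂leb (kerM B), GaussianDecay P fun u => T f (rangeCoord hT.symplectic (k, u)))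
    (w : (kerM B)ᗮ) : inner ℝ (P (M w)) (M w) ≤ inner ℝ (M w) w := by
  by_contra! hw
  have hzero := ae_eq_zero_of_slices hM hpos (memLp_two_chirped hT.symplectic f).1
    (hfM.mono fun _ => gaussianDecay_chirped) (hT.gaussianDecay_fourier_chirped hpos hfM hTfP) hw
  refine hf ((Lp.eq_zero_iff_ae_eq_zero).2 ?_)
  filter_upwards [(quasiMeasurePreserving_linearEquiv (decayCoord hT.symplectic).symm volume
    ((leb (kerM B)).prod (leb (kerM B)ᗮ))).ae hzero] with x hx
  rwa [Pi.zero_apply, ← norm_eq_zero, norm_chirped, ContinuousLinearEquiv.apply_symm_apply,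
    norm_eq_zero] at hx

theorem IsMetaplectic.exists_eq_mul_gaussian_mul_chirp
    (hT : IsMetaplectic (Matrix.fromBlocks A B C D) T) (hM : M.IsSymmetric)
    (hpos : ∀ x, x ≠ 0 → 0 < inner ℝ (M x) x)
    (hfM : ∀ᵐ k ∂leb (kerM B), GaussianDecay M fun v => f (decayCoord hT.symplectic (k, v)))
    (hTfP : ∀ᵐ k ∂leb (kerM B), GaussianDecay P fun u => T f (rangeCoord hT.symplectic (k, u)))
    (hMP : ∀ w, inner ℝ (P (M w)) (M w) = inner ℝ (M w) w) :
    ∃ γ : kerM B → ℂ, MemLp γ 2 (leb (kerM B)) ∧ ∀ᵐ k ∂leb (kerM B), ∀ᵐ v ∂leb (kerM B)ᗮ,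
      f (decayCoord hT.symplectic (k, v)) =
        γ k * gaussian M v * Complex.exp (-(Real.pi * Complex.I * chirp A C (k, v))) := by
  obtain ⟨γ, hγ, heq⟩ := exists_ae_eq_mul_gaussian_of_slices hM hpos
    (memLp_two_chirped hT.symplectic f) (hfM.mono fun _ => gaussianDecay_chirped)
    (hT.gaussianDecay_fourier_chirped hpos hfM hTfP) hMP
  refine ⟨γ, hγ, ?_⟩
  filter_upwards [heq] with k hk
  filter_upwards [hk] with v hv
  rw [← hv, chirped, mul_assoc, ← Complex.exp_add, add_neg_cancel, Complex.exp_zero, mul_one]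

end Chirped

theorem gaussianDecay_of_enorm_le {V : Type*} [NormedAddCommGroup V] [InnerProductSpace ℝ V]
    [FiniteDimensional ℝ V] [MeasurableSpace V] [BorelSpace V] {M : V →ₗ[ℝ] V} {g : V → ℂ}
    {a : ℝ≥0∞} (ha : a < ∞) (h : ∀ᵐ x, ‖g x‖ₑ ≤ a * ENNReal.ofReal (gaussian M x)) :
    GaussianDecay M g := by
  refine ⟨a.toReal, h.mono fun x hx => ?_⟩
  have hx' := ENNReal.toReal_mono (ENNReal.mul_ne_top ha.ne ENNReal.ofReal_ne_top) hx
  rwa [toReal_enorm, ENNReal.toReal_mul, ENNReal.toReal_ofReal (gaussian_pos M x).le] at hx'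

section Restriction

variable {d : ℕ} {A B C D E M N : Matrix (Fin d) (Fin d) ℝ}

theorem act_mem_orthogonal_kerM (hE : E.IsHermitian) (hEB : kerM E = kerM B) (x : Rd d) :
    act E x ∈ (kerM B)ᗮ := by
  rw [← hEB, orthogonal_kerM_of_isHermitian hE]
  exact ⟨x, rfl⟩

/-- A symmetric matrix with the same kernel as `B`, as an endomorphism of `(ker B)ᗮ`. -/
def restrictOrthogonal (hE : E.IsHermitian) (hEB : kerM E = kerM B) :
    (kerM B)ᗮ →ₗ[ℝ] (kerM B)ᗮ :=
  (act E).restrict fun x _ => act_mem_orthogonal_kerM hE hEB x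

theorem isSymmetric_restrictOrthogonal (hE : E.IsHermitian) (hEB : kerM E = kerM B) :
    (restrictOrthogonal hE hEB).IsSymmetric :=
  (Matrix.isSymmetric_toEuclideanLin_iff.2 hE).restrict_invariant _

theorem inner_restrictOrthogonal_self_pos (hE : E.PosSemidef) (hEB : kerM E = kerM B)
    (x : (kerM B)ᗮ) (hx : x ≠ 0) : 0 < inner ℝ (restrictOrthogonal hE.isHermitian hEB x) x := by
  refine (inner_act_self_nonneg hE x).lt_of_ne' fun h => hx (Subtype.ext ?_)
  exact Submodule.disjoint_def.1 (kerM B).orthogonal_disjoint _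
    (hEB.le ((inner_act_self_eq_zero_iff hE).1 h)) x.2

theorem inner_restrictOrthogonal_of_mul_mul_eq_self (hM : M.IsHermitian) (hMB : kerM M = kerM B)
    (hE : E.IsHermitian) (hEB : kerM E = kerM B) (h : M * E * M = M) (w : (kerM B)ᗮ) :
    inner ℝ (restrictOrthogonal hE hEB (restrictOrthogonal hM hMB w))
        (restrictOrthogonal hM hMB w) = inner ℝ (restrictOrthogonal hM hMB w) w := by
  have hcomp : restrictOrthogonal hM hMB
      (restrictOrthogonal hE hEB (restrictOrthogonal hM hMB w)) = restrictOrthogonal hM hMB w :=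
    Subtype.ext <|
      calc act M (act E (act M w)) = act (M * E * M) w := by rw [act_mul, act_mul]
        _ = act M w := by rw [h]
  rw [← isSymmetric_restrictOrthogonal hM hMB, hcomp]

theorem gaussianDecay_decayCoord {f : Rd d → ℂ}
    (hS : Matrix.fromBlocks A B C D ∈ Matrix.symplecticGroup (Fin d) ℝ)
    (hM : M.IsHermitian) (hMB : kerM M = kerM B) {α : (kerM B).map (act (Dᵀ * A)) → ℝ≥0∞}
    (hα : ∀ᵐ x₂ ∂leb _, α x₂ < ∞)
    (hf : ∀ᵐ x₂ ∂leb ((kerM B).map (act (Dᵀ * A))), ∀ᵐ x₁ ∂leb (kerM B)ᗮ,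
      ‖f (x₁.1 + x₂.1)‖ₑ ≤
        α x₂ * ENNReal.ofReal (Real.exp (-Real.pi * inner ℝ (act M x₁.1) x₁.1))) :
    ∀ᵐ k ∂leb (kerM B),
      GaussianDecay (restrictOrthogonal hM hMB) fun v => f (decayCoord hS (k, v)) := by
  have hinj (k : kerM B) (hk : act (Dᵀ * A) (k : Rd d) = 0) : k = 0 :=
    (eq_zero_of_act_transpose_mul_add_eq_zero hS k 0
      (by rw [hk, ZeroMemClass.coe_zero, add_zero])).1
  filter_upwards [ae_map_of_injOn _ _ hinj hα, ae_map_of_injOn _ _ hinj hf] with k hk hfk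
  refine gaussianDecay_of_enorm_le hk (hfk.mono fun v hv => ?_)
  rwa [decayCoord_apply, add_comm]

theorem gaussianDecay_rangeCoord {g : Rd d → ℂ}
    (hS : Matrix.fromBlocks A B C D ∈ Matrix.symplecticGroup (Fin d) ℝ)
    (hP : (Bᵀ * N * B).IsHermitian) (hPB : kerM (Bᵀ * N * B) = kerM B)
    {β : (kerM B).map (act A) → ℝ≥0∞} (hβ : ∀ᵐ ξ₂ ∂leb _, β ξ₂ < ∞)
    (hg : ∀ᵐ ξ₂ ∂leb ((kerM B).map (act A)), ∀ᵐ ξ₁ ∂leb (ranM B),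
      ‖g (ξ₁.1 + ξ₂.1)‖ₑ ≤
        β ξ₂ * ENNReal.ofReal (Real.exp (-Real.pi * inner ℝ (act N ξ₁.1) ξ₁.1))) :
    ∀ᵐ k ∂leb (kerM B),
      GaussianDecay (restrictOrthogonal hP hPB) fun u => g (rangeCoord hS (k, u)) := by
  have hinj (k : kerM B) (hk : act A (k : Rd d) = 0) : k = 0 :=
    (eq_zero_of_act_add_act_eq_zero hS k 0
      (by rw [hk, ZeroMemClass.coe_zero, map_zero, add_zero])).1
  have hquad (u : (kerM B)ᗮ) : inner ℝ (restrictOrthogonal hP hPB u) u =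
      inner ℝ (act N (act B u)) (act B u) := by
    calc inner ℝ (restrictOrthogonal hP hPB u) u = inner ℝ (act (Bᵀ * N * B) u) u.1 := rfl
      _ = inner ℝ (act N (act B u)) (act B u) := by rw [act_mul, act_mul, inner_act_transpose]
  filter_upwards [ae_map_of_injOn _ _ hinj hβ, ae_map_of_injOn _ _ hinj hg] with k hk hgk
  refine gaussianDecay_of_enorm_le hk ((ae_ranM hgk).mono fun u hu => ?_)
  rwa [rangeCoord_apply, add_comm, gaussian, hquad]

theorem gaussian_mul_exp_chirp (hM : M.IsHermitian) (hMB : kerM M = kerM B) (k : kerM B)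
    (v : (kerM B)ᗮ) :
    (gaussian (restrictOrthogonal hM hMB) v : ℂ) *
        Complex.exp (-(Real.pi * Complex.I * chirp A C (k, v))) =
      Complex.exp (-Real.pi * ((inner ℝ (act M v.1) v.1 : ℝ) +
          Complex.I * (inner ℝ (pinv B (act A v.1)) v.1 : ℝ))) *
        Complex.exp (-(2 * Real.pi * Complex.I * (inner ℝ (act (Cᵀ * A) k.1) v.1 : ℝ))) := by
  have hquad : inner ℝ (restrictOrthogonal hM hMB v) v = inner ℝ (act M v.1) v.1 := rfl
  rw [gaussian, hquad, Complex.ofReal_exp, ← Complex.exp_add, ← Complex.exp_add, chirp]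
  push_cast
  ring_nf

end Restriction

end HardyMetaplectic

end

theorem theorem4p1 {d r : ℕ} (A B C D M N : Matrix (Fin d) (Fin d) ℝ)
    (T : L2 d ≃ₗᵢ[ℂ] L2 d)
    (hT : IsMetaplectic (Matrix.fromBlocks A B C D) T)
    (hr : B.rank = r) (hr1 : 1 ≤ r)
    (hM : M.PosSemidef) (hN : N.PosSemidef)
    (hMB : kerM M = kerM B) (hNB : ranM N = ranM B)
    (f : L2 d) (hf : f ≠ 0)
    (α : ((kerM B).map (act (Dᵀ * A))) → ℝ≥0∞) (β : ((kerM B).map (act A)) → ℝ≥0∞)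
    (hα : AEMeasurable α (leb _)) (hα_fin : ∀ᵐ x₂ ∂(leb _), α x₂ < ∞)
    (hβ : AEMeasurable β (leb _)) (hβ_fin : ∀ᵐ ξ₂ ∂(leb _), β ξ₂ < ∞)
    (hf_decay : ∀ᵐ x₂ ∂(leb ((kerM B).map (act (Dᵀ * A)))), ∀ᵐ x₁ ∂(leb (kerM B)ᗮ),
      ‖f (x₁.1 + x₂.1)‖ₑ ≤
        α x₂ * ENNReal.ofReal (Real.exp (-Real.pi * inner ℝ (act M x₁.1) x₁.1)))
    (hTf_decay : ∀ᵐ ξ₂ ∂(leb ((kerM B).map (act A))), ∀ᵐ ξ₁ ∂(leb (ranM B)),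
      ‖T f (ξ₁.1 + ξ₂.1)‖ₑ ≤
        β ξ₂ * ENNReal.ofReal (Real.exp (-Real.pi * inner ℝ (act N ξ₁.1) ξ₁.1))) :
    (nonzeroEigenvalues (M * Bᵀ * N * B)).card = r ∧
    (∀ μ ∈ nonzeroEigenvalues (M * Bᵀ * N * B), μ ≤ 1) ∧
    ((∀ μ ∈ nonzeroEigenvalues (M * Bᵀ * N * B), μ = 1) →
      ∃ γ : kerM B → ℂ, MemLp γ 2 (leb (kerM B)) ∧
        ∀ᵐ x ∂(leb (kerM B)), ∀ᵐ x₁ ∂(leb (kerM B)ᗮ),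
          f (x₁.1 + act (Dᵀ * A) x.1) =
            γ x *
              Complex.exp (-Real.pi *
                ((inner ℝ (act M x₁.1) x₁.1 : ℝ) +
                  Complex.I * (inner ℝ (pinv B (act A x₁.1)) x₁.1 : ℝ))) *
              Complex.exp (-(2 * Real.pi * Complex.I *
                (inner ℝ (act (Cᵀ * A) x.1) x₁.1 : ℝ)))) := by
  have hP : (Bᵀ * N * B).PosSemidef := hN.conjTranspose_mul_mul_same B
  have hPB : kerM (Bᵀ * N * B) = kerM B := kerM_transpose_mul_mul hN hNB
  have hker : kerM M = kerM (Bᵀ * N * B) := hMB.trans hPB.symm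
  have hsym := isSymmetric_restrictOrthogonal hM.isHermitian hMB
  have hpos := inner_restrictOrthogonal_self_pos hM hMB
  have hfM := gaussianDecay_decayCoord hT.symplectic hM.isHermitian hMB hα_fin hf_decay
  have hTfP := gaussianDecay_rangeCoord hT.symplectic hP.isHermitian hPB hβ_fin hTf_decay
  rw [show M * Bᵀ * N * B = M * (Bᵀ * N * B) by simp only [Matrix.mul_assoc]]
  refine ⟨by rw [card_nonzeroEigenvalues_mul hM hP hker, rank_eq_of_kerM_eq hPB, hr],
    fun μ => le_one_of_mem_nonzeroEigenvalues_mul hP fun w hw =>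
      hT.inner_le_of_gaussianDecay_slices hsym hpos hf hfM hTfP ⟨w, hPB ▸ hw⟩, fun hone => ?_⟩
  have hMPM := mul_mul_eq_self_of_nonzeroEigenvalues_eq_one hM hP hker hone
  obtain ⟨γ, hγ, heq⟩ := hT.exists_eq_mul_gaussian_mul_chirp hsym hpos hfM hTfP
    (inner_restrictOrthogonal_of_mul_mul_eq_self hM.isHermitian hMB hP.isHermitian hPB hMPM)
  refine ⟨γ, hγ, heq.mono fun k hk => hk.mono fun v hv => ?_⟩
  rw [add_comm, mul_assoc, ← gaussian_mul_exp_chirp hM.isHermitian hMB, ← mul_assoc, ← hv,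
    decayCoord_apply]
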